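/- Let $H_0\ge 0$ be a positive self-adjoint operator on a complex Hilbert space $\mathcal H$, let $Q_0=D(H_0^{1/2})$ and $q_0(\varphi,\psi)=\langle H_0^{1/2}\varphi,H_0^{1/2}\psi\rangle$ for $\varphi,\psi\in Q_0$, and let $\beta_0\ge 0$ be such that $e^{-\beta H_0}$ is of trace class for every $\beta>\beta_0$. Let $X$ be a symmetric sesquilinear form on $Q_0$, and let $a,b$ be real numbers with $0\le a<1-\beta_0$ and $$|X(\psi,\psi)|\le a\,q_0(\psi,\psi)+b\,\|\psi\|^2\qquad\text{for all }\psi\in Q_0 .$$ Let $H_X$ be the operator associated with the form $q_0+X$ on $Q_0$ (the KLMN operator): $\varphi\in Q_0$ belongs to $D(H_X)$ and $H_X\varphi=\eta$ if and only if $q_0(\psi,\varphi)+X(\psi,\varphi)=\langle\psi,\eta\rangle$ for all $\psi\in Q_0$. Then $H_X$ is self-adjoint and bounded below by $-b$, and: 1. the spectrum of $H_X$ is purely discrete, i.e. it consists of isolated eigenvalues of finite multiplicity; 2. $e^{-\beta H_X}$ is of trace class for every $\beta>\beta_X=\beta_0/(1-a)$; 3. for every $\beta>0$, with traces taken in $[0,\infty]$,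 $$e^{-b\beta}\,{\rm Tr}\,e^{-(1+a)\beta H_0}\;\le\;{\rm Tr}\,e^{-\beta H_X}\;\le\;e^{b\beta}\,{\rm Tr}\,e^{-(1-a)\beta H_0}.$$ -/

import Mathlib

open scoped InnerProductSpace ComplexConjugate ENNReal

noncomputable section

namespace FormPerturbation

variable {E : Type*} [NormedAddCommGroup E] [InnerProductSpace ℂ E]

/-- The bounded operator `R` is a two-sided inverse of `A - z`, for an unbounded operator `A`. -/
def IsInverseOfSub (A : E →ₗ.[ℂ] E) (z : ℂ) (R : E →L[ℂ] E) : Prop :=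
  (∀ y : E, ∃ h : R y ∈ A.domain, A ⟨R y, h⟩ - z • R y = y) ∧
    ∀ x : A.domain, R (A x - z • (x : E)) = x

open Classical in
/-- The resolvent `(A - z)⁻¹` at a point `z` of the resolvent set (and `0` elsewhere). -/
def res (A : E →ₗ.[ℂ] E) (z : ℂ) : E →L[ℂ] E :=
  if h : ∃ R : E →L[ℂ] E, IsInverseOfSub A z R then h.choose else 0

/-- The spectrum of an unbounded operator: the `z` for which `A - z` has no bounded inverse. -/
def spec (A : E →ₗ.[ℂ] E) : Set ℂ :=
  {z | ¬ ∃ R : E →L[ℂ] E, IsInverseOfSub A z R}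

/-- The eigenspace `ker (A - z)`, as a subspace of the domain of `A`. -/
def eigenspace (A : E →ₗ.[ℂ] E) (z : ℂ) : Submodule ℂ A.domain :=
  LinearMap.ker (A.toFun - z • A.domain.subtype)

/-- Purely discrete spectrum (of a self-adjoint operator): every point of the spectrum is an
isolated point of the spectrum and an eigenvalue of finite multiplicity. -/
def HasPurelyDiscreteSpectrum (A : E →ₗ.[ℂ] E) : Prop :=
  ∀ z ∈ spec A, (∃ ε > 0, ∀ w ∈ spec A, w ≠ z → ε ≤ dist w z) ∧
    eigenspace A z ≠ ⊥ ∧ FiniteDimensional ℂ (eigenspace A z)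

/-- `A ≥ m` in the sense of quadratic forms on the domain of `A`. -/
def IsBoundedBelowBy (A : E →ₗ.[ℂ] E) (m : ℝ) : Prop :=
  ∀ x : A.domain, m * ‖(x : E)‖ ^ 2 ≤ (⟪(x : E), A x⟫_ℂ).re

/-- The greatest lower bound of a semibounded operator. -/
def lowerBound (A : E →ₗ.[ℂ] E) : ℝ := sSup {m : ℝ | IsBoundedBelowBy A m}

/-- The graph of the operator associated with the sesquilinear form `q` on `Q`: all `(φ, η)` with
`φ ∈ Q` and `q(ψ, φ) = ⟨ψ, η⟩` for every `ψ ∈ Q`. -/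
def formGraph (Q : Submodule ℂ E) (q : Q →ₗ⋆[ℂ] Q →ₗ[ℂ] ℂ) : Submodule ℂ (E × E) where
  carrier := {p | ∃ h : p.1 ∈ Q, ∀ ψ : Q, q ψ ⟨p.1, h⟩ = ⟪(ψ : E), p.2⟫_ℂ}
  zero_mem' := ⟨Q.zero_mem, fun ψ => by
    have : (⟨0, Q.zero_mem⟩ : Q) = 0 := rfl
    simp [this]⟩
  add_mem' := by
    rintro x y ⟨hx, hx'⟩ ⟨hy, hy'⟩
    refine ⟨Q.add_mem hx hy, fun ψ => ?_⟩
    have : (⟨(x + y).1, Q.add_mem hx hy⟩ : Q) = ⟨x.1, hx⟩ + ⟨y.1, hy⟩ := rfl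
    rw [this, map_add, hx', hy', Prod.snd_add, inner_add_right]
  smul_mem' := by
    rintro c x ⟨hx, hx'⟩
    refine ⟨Q.smul_mem c hx, fun ψ => ?_⟩
    have : (⟨(c • x).1, Q.smul_mem c hx⟩ : Q) = c • ⟨x.1, hx⟩ := rfl
    rw [this, map_smul, hx', Prod.smul_snd, inner_smul_right, smul_eq_mul]

/-- The operator associated with a form `q` on a dense subspace `Q`: its domain consists of the
`φ ∈ Q` for which some (unique) `η` satisfies `q(ψ, φ) = ⟨ψ, η⟩` for every `ψ ∈ Q`, and it maps `φ`
to `η`. For a closed symmetric form that is bounded below this is the self-adjoint operator with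
form domain `Q` and form `q`. -/
def formOperator (Q : Submodule ℂ E) (q : Q →ₗ⋆[ℂ] Q →ₗ[ℂ] ℂ) : E →ₗ.[ℂ] E :=
  (formGraph Q q).toLinearPMap

variable [CompleteSpace E]

/-- The positive square root `A^{1/2}` of a positive self-adjoint operator `A`. By the functional
calculus for `B = (A + 1)⁻¹`, where `0 ≤ B ≤ 1`, it is `(1 - B)^{1/2} (B^{1/2})⁻¹`, with the
range of `B^{1/2}` as its domain. -/
def sqrtOp (A : E →ₗ.[ℂ] E) : E →ₗ.[ℂ] E :=
  ((cfc (fun r : ℝ => √(1 - r)) (res A (-1)) : E →L[ℂ] E) : E →ₗ[ℂ] E).compPMap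
    (((cfc Real.sqrt (res A (-1)) : E →L[ℂ] E) : E →ₗ[ℂ] E).toPMap ⊤).inverse

/-- The form domain `Q(A) = D(A^{1/2})` of a positive self-adjoint operator. -/
abbrev formDomain (A : E →ₗ.[ℂ] E) : Submodule ℂ E := (sqrtOp A).domain

/-- The form `⟨A^{1/2} φ, A^{1/2} ψ⟩` of a positive self-adjoint operator `A`. -/
def form (A : E →ₗ.[ℂ] E) : formDomain A →ₗ⋆[ℂ] formDomain A →ₗ[ℂ] ℂ :=
  ((innerₛₗ ℂ).comp (sqrtOp A).toFun).compl₂ (sqrtOp A).toFun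

/-- The operator `H_X`: the self-adjoint operator whose form is `q₀ + X` on the form domain `Q₀`,
for `q₀` the form of the positive self-adjoint operator `H₀`. -/
def perturbed (H₀ : E →ₗ.[ℂ] E) (X : formDomain H₀ →ₗ⋆[ℂ] formDomain H₀ →ₗ[ℂ] ℂ) :
    E →ₗ.[ℂ] E :=
  formOperator (formDomain H₀) (form H₀ + X)

/-- The semigroup `exp (-β A)`, `β > 0`, of a self-adjoint operator `A` that is bounded below. With
`m` the lower bound of `A` and `R = (A - (m - 1))⁻¹`, so that `0 ≤ R ≤ 1`, one has
`A = R⁻¹ + m - 1`, and `exp (-β A)` is the corresponding continuous function of `R`. -/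
def expNeg (A : E →ₗ.[ℂ] E) (β : ℝ) : E →L[ℂ] E :=
  cfc (fun r : ℝ => if r ≤ 0 then 0 else Real.exp (-(β * (r⁻¹ + lowerBound A - 1))))
    (res A ((lowerBound A - 1 : ℝ) : ℂ))

/-- The trace, in `[0, ∞]`, of a positive bounded operator: `∑ ⟨e, T e⟩` over an orthonormal basis
(it does not depend on the basis). -/
def posTrace (T : E →L[ℂ] E) : ℝ≥0∞ :=
  ∑' e : (exists_hilbertBasis ℂ E).choose, ENNReal.ofReal (⟪(e : E), T e⟫_ℂ).re

/-- `T` is of trace class: `|T| = (T* T)^{1/2}` has finite trace. -/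
def IsTraceClass (T : E →L[ℂ] E) : Prop := posTrace (CFC.abs T) ≠ ∞

end FormPerturbation

end

/-!
The comparison of traces rests on Jensen's inequality instead of the min-max principle. If `H` is
the self-adjoint operator of a form `q` that is bounded below, if `H` has an orthonormal basis of
eigenvectors, and if `ψ` is a unit vector in the form domain, then
`exp (-β q(ψ, ψ)) ≤ ⟨ψ, exp (-β H) ψ⟩` (`IsFormBounded.exp_neg_form_le`). Let now `q` and `q'` be
two such forms on the same domain with `β' q' ≤ β q + s` on unit vectors, and let `e i` be an eigenbasis
of `H` with eigenvalues `l i = q(e i, e i)`. Then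
`exp (-β l i) ≤ exp s * exp (-β' q'(e i, e i)) ≤ exp s * ⟨e i, exp (-β' H') (e i)⟩`,
and summation gives `Tr exp (-β H) ≤ exp s * Tr exp (-β' H')`, since the trace of a positive
operator does not depend on the basis (`IsFormBounded.posTrace_expNeg_le`). Both bounds on
`Tr exp (-β H_X)` are instances of this, as `(1 - a) q₀ - b ≤ q₀ + X ≤ (1 + a) q₀ + b` on unit
vectors and `H₀` is itself the perturbation of `H₀` by the zero form (`perturbed_zero`).

The eigenbases come from compact resolvents. A positive operator of finite trace is compact, and
the resolvent of `H₀` is a norm limit of products of `exp (-β H₀)` with bounded operators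
(`isCompactOperator_of_isTraceClass_expNeg`). With `S = (H₀ + 1)^{-1/2}`, which maps the space
bijectively onto the form domain, the form `q₀ + X + b + 1` becomes a bounded coercive form
`⟨g, M h⟩` in the variables `S g`, `S h`, and `(H_X + b + 1)⁻¹ = S M⁻¹ S`
(`IsFormBounded.exists_isInverseOfSub_perturbed`). This operator is symmetric, which makes `H_X`
self-adjoint, and it is compact, which makes the spectrum of `H_X` purely discrete by the Fredholm
alternative (`hasPurelyDiscreteSpectrum`).
-/

namespace FormPerturbation

open Filter Topology

universe u

section Bounded

variable {E : Type u} [NormedAddCommGroup E] [InnerProductSpace ℂ E]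

/-! ### Compactness, functional calculus and traces of bounded operators -/

lemma finite_of_compact_of_separated {X : Type*} [MetricSpace X] {ι : Type*} {K : Set X}
    (hK : IsCompact K) {s : Set ι} (x : ι → X) (hx : ∀ i ∈ s, x i ∈ K) {ε : ℝ} (hε : 0 < ε)
    (hsep : ∀ i ∈ s, ∀ j ∈ s, i ≠ j → ε ≤ dist (x i) (x j)) : s.Finite := by
  by_contra hs
  have hs : s.Infinite := hs
  let f := hs.natEmbedding
  obtain ⟨a, -, φ, hφ, hlim⟩ := hK.tendsto_subseq (x := fun n => x (f n)) fun n => hx _ (f n).2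
  obtain ⟨N, hN⟩ := Metric.cauchySeq_iff.1 hlim.cauchySeq ε hε
  have h1 := hN N le_rfl (N + 1) (Nat.le_succ N)
  refine absurd h1 (not_lt.2 (hsep _ (f _).2 _ (f _).2 fun h => ?_))
  have := hφ.injective (f.injective (Subtype.ext h))
  omega

variable [CompleteSpace E]

/-- The functional calculus acts on eigenvectors as expected; this holds for polynomials, hence by
the Weierstrass theorem for continuous functions. -/
lemma cfc_apply_eigenvector {T : E →L[ℂ] E} (hT : IsSelfAdjoint T) {e : E} (he : e ≠ 0) {r : ℝ}
    (hr : T e = (r : ℂ) • e) {f : ℝ → ℝ} (hf : ContinuousOn f (spectrum ℝ T)) :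
    cfc f T e = (f r : ℂ) • e := by
  have hmem : r ∈ spectrum ℝ T := by
    intro hu
    obtain ⟨u, hu⟩ := hu
    have h0 : (algebraMap ℝ (E →L[ℂ] E) r - T) e = 0 := by
      rw [Algebra.algebraMap_eq_smul_one]
      simp [hr]
    have h1 : ((↑u⁻¹ : E →L[ℂ] E) * (u : E →L[ℂ] E)) e = 0 := by
      rw [hu, mul_apply_eq_comp, h0, map_zero]
    rw [Units.inv_mul] at h1
    exact he h1
  rw [cfc_apply f T hT hf]
  suffices H : ∀ g : C(spectrum ℝ T, ℝ),
      cfcHom (p := IsSelfAdjoint) hT g e = (g ⟨r, hmem⟩ : ℂ) • e from H _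
  intro g
  have hid : cfcHom (p := IsSelfAdjoint) hT
      (ContinuousMap.restrict (spectrum ℝ T) (ContinuousMap.id ℝ)) e = (r : ℂ) • e := by
    rw [cfcHom_id, hr]
  induction g using ContinuousMap.induction_on_of_compact with
  | const c =>
    have : ContinuousMap.const (spectrum ℝ T) c = algebraMap ℝ C(spectrum ℝ T, ℝ) c := rfl
    rw [this, AlgHomClass.commutes, Algebra.algebraMap_eq_smul_one]
    simp
  | id => exact hid
  | star_id => rw [star_trivial]; exact hid
  | add f g hf hg => simp [map_add, hf, hg, add_smul]
  | mul f g hf hg =>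
    rw [map_mul, mul_apply_eq_comp, hg, map_smul, hf, smul_smul]
    simp [mul_comm]
  | frequently f h =>
    have hc : IsClosed {g : C(spectrum ℝ T, ℝ) |
        cfcHom (p := IsSelfAdjoint) hT g e = (g ⟨r, hmem⟩ : ℂ) • e} := by
      refine isClosed_eq ?_ ?_
      · exact ((cfcHom_continuous (p := IsSelfAdjoint) hT).clm_apply continuous_const)
      · fun_prop
    exact hc.mem_of_frequently_of_tendsto h tendsto_id

/-- If `f(T)` is compact and `f` is positive on `(0, ∞)`, then `g(T)` is compact for every
continuous `g` that vanishes at `0`: away from `0`, `g` is a multiple of `f`. -/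
lemma isCompactOperator_cfc_of_isCompactOperator_cfc {T : E →L[ℂ] E} (hT : 0 ≤ T) {f g : ℝ → ℝ}
    (hf : Continuous f) (hg : Continuous g) (hpos : ∀ r, 0 < r → 0 < f r) (hg0 : g 0 = 0)
    (hcomp : IsCompactOperator (cfc f T : E →L[ℂ] E)) :
    IsCompactOperator (cfc g T : E →L[ℂ] E) := by
  have hsa : IsSelfAdjoint T := .of_nonneg hT
  have hcl : IsClosed {S : E →L[ℂ] E | IsCompactOperator S} :=
    isClosed_setOfPred_isCompactOperator
  refine hcl.closure_subset (Metric.mem_closure_iff.2 fun ε hε => ?_)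
  obtain ⟨δ, hδ, hgδ⟩ := Metric.continuous_iff.1 hg 0 (ε / 2) (half_pos hε)
  -- a cutoff that vanishes on `[0, δ / 2]` and equals `1` on `[δ, ∞)`
  let χ : ℝ → ℝ := fun r => max 0 (min 1 (2 * r / δ - 1))
  have hχc : Continuous χ := by fun_prop
  have hχ0 : ∀ r, r ≤ δ / 2 → χ r = 0 := fun r hr => by
    refine max_eq_left ((min_le_right _ _).trans ?_)
    rw [sub_nonpos, div_le_one hδ]; linarith
  have hχ1 : ∀ r, δ ≤ r → χ r = 1 := fun r hr => by
    have : min 1 (2 * r / δ - 1) = 1 := by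
      refine min_eq_left ?_
      rw [le_sub_iff_add_le, le_div_iff₀ hδ]; linarith
    simp [χ, this]
  have hχnn : ∀ r, 0 ≤ χ r := fun r => le_max_left _ _
  have hχle : ∀ r, χ r ≤ 1 := fun r => max_le zero_le_one (min_le_left _ _)
  let k : ℝ → ℝ := fun r => g r * χ r / f (max r (δ / 2))
  have hkc : Continuous k := by
    refine (hg.mul hχc).div₀ (hf.comp (by fun_prop)) fun r => (hpos _ ?_).ne'
    exact lt_max_of_lt_right (half_pos hδ)
  have hkf : ∀ r, k r * f r = g r * χ r := fun r => by
    rcases le_or_gt r (δ / 2) with h | h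
    · simp [k, hχ0 r h]
    · have := (hpos r ((half_pos hδ).trans h)).ne'
      simp only [k, max_eq_left h.le]
      field_simp
  refine ⟨cfc k T * cfc f T, hcomp.clm_comp (cfc k T), ?_⟩
  rw [dist_eq_norm, ← cfc_mul k f T hkc.continuousOn hf.continuousOn,
    ← cfc_sub g (fun r => k r * f r) T hg.continuousOn (hkc.mul hf).continuousOn]
  refine (norm_cfc_le (half_pos hε).le fun r hr => ?_).trans_lt (half_lt_self hε)
  rw [hkf]
  have hr0 : 0 ≤ r := spectrum_nonneg_of_nonneg hT hr
  rcases le_or_gt δ r with h | h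
  · simpa [hχ1 r h] using (half_pos hε).le
  · have h1 := hgδ r (by simpa [abs_of_nonneg hr0] using h)
    rw [hg0, dist_zero_right] at h1
    have : g r - g r * χ r = g r * (1 - χ r) := by ring
    rw [this, norm_mul]
    refine (mul_le_of_le_one_right (norm_nonneg _) ?_).trans h1.le
    rw [Real.norm_eq_abs, abs_of_nonneg (by linarith [hχle r])]
    linarith [hχnn r]

omit [CompleteSpace E] in
lemma hasSum_norm_inner_sq {ι : Type*} (e : HilbertBasis ι ℂ E) (x : E) :
    HasSum (fun i => ‖⟪e i, x⟫_ℂ‖ ^ 2) (‖x‖ ^ 2) := by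
  have h := Complex.hasSum_re (e.hasSum_inner_mul_inner x x)
  convert h using 1
  · ext i
    rw [← inner_conj_symm x (e i), ← Complex.normSq_eq_conj_mul_self, Complex.ofReal_re,
      Complex.normSq_eq_norm_sq]
  · rw [inner_self_eq_norm_sq_to_K]
    norm_cast

/-- A positive operator is the square of a self-adjoint one, and `⟨x, T x⟩ = ‖T^{1/2} x‖²`. -/
lemma exists_sqrt {T : E →L[ℂ] E} (hT : 0 ≤ T) : ∃ U : E →L[ℂ] E, U * U = T ∧
    (∀ x y, ⟪U x, y⟫_ℂ = ⟪x, U y⟫_ℂ) ∧ ∀ x, (⟪x, T x⟫_ℂ).re = ‖U x‖ ^ 2 := by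
  have hsa : IsSelfAdjoint (CFC.sqrt T) := .of_nonneg (CFC.sqrt_nonneg T)
  have hsym : ∀ x y, ⟪CFC.sqrt T x, y⟫_ℂ = ⟪x, CFC.sqrt T y⟫_ℂ := hsa.isSymmetric
  refine ⟨CFC.sqrt T, CFC.sqrt_mul_sqrt_self T hT, hsym, fun x => ?_⟩
  have h1 : T x = CFC.sqrt T (CFC.sqrt T x) := by
    rw [← mul_apply_eq_comp, CFC.sqrt_mul_sqrt_self T hT]
  rw [h1, ← hsym, inner_self_eq_norm_sq_to_K]
  norm_cast

omit [CompleteSpace E] in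
lemma tsum_ofReal_norm_apply_sq {ι κ : Type*} (e : HilbertBasis ι ℂ E) (f : HilbertBasis κ ℂ E)
    {U : E →L[ℂ] E} (hU : ∀ x y, ⟪U x, y⟫_ℂ = ⟪x, U y⟫_ℂ) :
    ∑' i, ENNReal.ofReal (‖U (e i)‖ ^ 2) = ∑' j, ENNReal.ofReal (‖U (f j)‖ ^ 2) := by
  have key : ∀ {ι κ : Type _} (e : HilbertBasis ι ℂ E) (f : HilbertBasis κ ℂ E),
      ∑' i, ENNReal.ofReal (‖U (e i)‖ ^ 2) =
        ∑' i, ∑' j, ENNReal.ofReal (‖⟪f j, U (e i)⟫_ℂ‖ ^ 2) := fun e f => by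
    refine tsum_congr fun i => ?_
    have h := hasSum_norm_inner_sq f (U (e i))
    rw [← h.tsum_eq, ENNReal.ofReal_tsum_of_nonneg (fun _ => by positivity) h.summable]
  rw [key e f, ENNReal.tsum_comm]
  refine tsum_congr fun j => ?_
  have h := hasSum_norm_inner_sq e (U (f j))
  rw [← h.tsum_eq, ENNReal.ofReal_tsum_of_nonneg (fun _ => by positivity) h.summable]
  refine tsum_congr fun i => ?_
  rw [← hU, norm_inner_symm]

/-- The trace of a positive operator may be computed in any orthonormal basis. -/
lemma posTrace_eq_tsum {ι : Type*} (e : HilbertBasis ι ℂ E) {T : E →L[ℂ] E} (hT : 0 ≤ T) :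
    posTrace T = ∑' i, ENNReal.ofReal (⟪e i, T (e i)⟫_ℂ).re := by
  obtain ⟨U, -, hU, hUT⟩ := exists_sqrt hT
  obtain ⟨b, hb⟩ := (exists_hilbertBasis ℂ E).choose_spec
  have h := tsum_ofReal_norm_apply_sq b e hU
  unfold posTrace
  simp only [hUT]
  rw [← h, hb]

lemma isTraceClass_iff_of_nonneg {T : E →L[ℂ] E} (hT : 0 ≤ T) :
    IsTraceClass T ↔ posTrace T ≠ ∞ := by
  rw [IsTraceClass, CFC.abs_of_nonneg T hT]

/-- A positive operator of finite trace is compact: its square root `U` satisfies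
`∑ ‖U e i‖² < ∞`, so that it is the norm limit of its finite rank truncations. -/
lemma isCompactOperator_of_posTrace_ne_top {T : E →L[ℂ] E} (hT : 0 ≤ T) (htr : posTrace T ≠ ∞) :
    IsCompactOperator T := by
  obtain ⟨U, hUU, hU, hUT⟩ := exists_sqrt hT
  obtain ⟨w, e, -⟩ := exists_hilbertBasis ℂ E
  rw [posTrace_eq_tsum e hT] at htr
  simp only [hUT] at htr
  have hsum : Summable fun i => ‖U (e i)‖ ^ 2 := by
    have := ENNReal.summable_toReal htr
    simpa [ENNReal.toReal_ofReal] using this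
  have hUc : IsCompactOperator U := by
    classical
    let P : Finset w → E →L[ℂ] E := fun F =>
      ∑ i ∈ F, (innerSL ℂ (e i)).smulRight (e i)
    have hP : ∀ F x, P F x = ∑ i ∈ F, ⟪e i, x⟫_ℂ • e i := fun F x => by
      simp [P]
    have hPc : ∀ F, IsCompactOperator (P F * U) := fun F => by
      have : IsCompactOperator (P F) := by
        refine Finset.induction_on F ?_ ?_
        · simpa [P] using isCompactOperator_zero
        · intro i F hi h
          have h1 : IsCompactOperator ((innerSL ℂ (e i)).smulRight (e i)) := by
            have : IsCompactOperator (innerSL ℂ (e i)) :=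
              isCompactOperator_of_locallyCompactSpace_dom (innerSL ℂ (e i))
            exact this.clm_comp ((ContinuousLinearMap.id ℂ ℂ).smulRight (e i))
          have := h1.add h
          simpa [P, Finset.sum_insert hi] using this
      exact this.comp_clm U
    refine isCompactOperator_of_tendsto (l := atTop) (F := fun F => P F * U) ?_ (.of_forall hPc)
    rw [Metric.tendsto_nhds]
    intro ε hε
    have htail := tendsto_tsum_compl_atTop_zero (fun i => ‖U (e i)‖ ^ 2)
    filter_upwards [(tendsto_order.1 htail).2 (ε ^ 2 / 4) (by positivity)] with F hF
    rw [dist_comm, dist_eq_norm]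
    refine (ContinuousLinearMap.opNorm_le_bound _ (half_pos hε).le fun x => ?_).trans_lt
      (half_lt_self hε)
    -- Parseval: `v = U x - P F (U x)` has the coefficients `⟨U e j, x⟩`, `j ∉ F`
    set v : E := (U - P F * U) x with hv
    have hvx : v = U x - P F (U x) := rfl
    have hvin : ∀ j ∈ F, ⟪e j, v⟫_ℂ = 0 := fun j hj => by
      rw [hvx, hP, inner_sub_right, e.orthonormal.inner_right_sum _ hj, sub_self]
    have hvout : ∀ j ∉ F, ⟪e j, v⟫_ℂ = ⟪U (e j), x⟫_ℂ := fun j hj => by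
      rw [hvx, hP, inner_sub_right, inner_sum, Finset.sum_eq_zero, sub_zero, hU]
      intro i hi
      rw [inner_smul_right, e.orthonormal.inner_eq_zero (ne_of_mem_of_not_mem hi hj).symm, mul_zero]
    have h1 := hasSum_norm_inner_sq e v
    have h2 := (hsum.indicator (F : Set w)ᶜ).hasSum.mul_right (‖x‖ ^ 2)
    rw [← tsum_subtype] at h2
    have h3 : ‖v‖ ^ 2 ≤ _ := hasSum_le (fun j => ?_) h1 h2
    · have h4 : ‖v‖ ^ 2 ≤ (ε / 2 * ‖x‖) ^ 2 := by
        refine h3.trans ?_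
        have : (ε / 2 * ‖x‖) ^ 2 = ε ^ 2 / 4 * ‖x‖ ^ 2 := by ring
        rw [this]
        exact mul_le_mul_of_nonneg_right hF.le (by positivity)
      exact le_of_sq_le_sq h4 (by positivity)
    · by_cases hj : j ∈ F
      · simp [hvin j hj, hj]
      · rw [hvout j hj, Set.indicator_of_mem (by simpa using hj), ← mul_pow]
        gcongr
        exact norm_inner_le_norm _ _
  rw [← hUU]
  exact hUc.comp_clm U

/-- The spectral theorem for compact self-adjoint operators, in terms of an orthonormal basis. -/
lemma exists_hilbertBasis_eigenvectors {T : E →L[ℂ] E} (hT : IsSelfAdjoint T)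
    (hc : IsCompactOperator T) :
    ∃ (ι : Type u) (e : HilbertBasis ι ℂ E) (r : ι → ℝ), ∀ i, T (e i) = (r i : ℂ) • e i := by
  have hsym : (T : E →ₗ[ℂ] E).IsSymmetric := hT.isSymmetric
  let V : ℂ → Submodule ℂ E := fun μ => Module.End.eigenspace (T : E →ₗ[ℂ] E) μ
  have hVc : ∀ μ, CompleteSpace (V μ) := fun μ => by
    have : IsClosed (V μ : Set E) := by
      have : (V μ : Set E) = {x | T x = μ • x} := by
        ext x; simp [V]
      rw [this]
      exact isClosed_eq T.continuous (by fun_prop)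
    exact this.completeSpace_coe
  choose w b hb using fun μ => exists_hilbertBasis ℂ (V μ)
  have hon : Orthonormal ℂ fun a : Σ μ, w μ => ((b a.1 a.2 : V a.1) : E) :=
    hsym.orthogonalFamily_eigenspaces.orthonormal_sigma_orthonormal fun μ => (b μ).orthonormal
  have hbot :
      (Submodule.span ℂ (Set.range fun a : Σ μ, w μ => ((b a.1 a.2 : V a.1) : E)))ᗮ = ⊥ := by
    rw [eq_bot_iff, ← ContinuousLinearMap.orthogonalComplement_iSup_eigenspaces_eq_bot hc hsym,
      ← Submodule.iInf_orthogonal]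
    intro x hx
    rw [Submodule.mem_iInf]
    intro μ
    rw [Submodule.mem_orthogonal]
    intro u hu
    have h1 := (b μ).hasSum_repr ⟨u, hu⟩
    have h2 := (V μ).subtypeL.hasSum h1
    have h3 := ((innerSL ℂ x).hasSum h2)
    have h4 : ∀ i, ⟪x, (b μ i : E)⟫_ℂ = 0 := fun i => by
      rw [← inner_conj_symm, (Submodule.mem_orthogonal _ _).1 hx _
        (Submodule.subset_span ⟨⟨μ, i⟩, rfl⟩), map_zero]
    simp only [innerSL_apply_apply, Submodule.subtypeL_apply,
      Submodule.coe_smul, inner_smul_right, h4, mul_zero] at h3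
    rw [← inner_conj_symm, show ⟪x, u⟫_ℂ = 0 from h3.unique hasSum_zero, map_zero]
  refine ⟨Σ μ, w μ, HilbertBasis.mkOfOrthogonalEqBot hon hbot, fun a => a.1.re, fun a => ?_⟩
  rw [HilbertBasis.coe_mkOfOrthogonalEqBot]
  have h1 : T (b a.1 a.2 : V a.1) = a.1 • ((b a.1 a.2 : V a.1) : E) :=
    Module.End.mem_eigenspace_iff.1 (b a.1 a.2).2
  have hne : ((b a.1 a.2 : V a.1) : E) ≠ 0 := hon.ne_zero a
  have h2 : conj a.1 = a.1 :=
    hsym.conj_eigenvalue_eq_self (Module.End.hasEigenvalue_of_hasEigenvector ⟨(b a.1 a.2).2, hne⟩)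
  rw [h1, Complex.conj_eq_iff_re.1 h2]

omit [CompleteSpace E] in
lemma finite_setOf_le_eigenvalue {T : E →L[ℂ] E} (hc : IsCompactOperator T) {ι : Type*}
    (e : HilbertBasis ι ℂ E) (r : ι → ℝ) (hr : ∀ i, T (e i) = (r i : ℂ) • e i) {ε : ℝ}
    (hε : 0 < ε) : {i | ε ≤ r i}.Finite := by
  refine finite_of_compact_of_separated (hc.isCompact_closure_image_closedBall 1)
    (fun i => T (e i)) (fun i _ => subset_closure ⟨e i, ?_, rfl⟩) hε fun i hi j hj hij => ?_
  · simp [e.orthonormal.norm_eq_one]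
  · rw [dist_eq_norm]
    have h1 : ⟪e i, T (e i) - T (e j)⟫_ℂ = r i := by
      simp [hr, e.orthonormal.inner_eq_zero hij,
        inner_self_eq_norm_sq_to_K, e.orthonormal.norm_eq_one]
    have h2 := norm_inner_le_norm (𝕜 := ℂ) (e i) (T (e i) - T (e j))
    rw [h1, e.orthonormal.norm_eq_one, one_mul, Complex.norm_real] at h2
    exact (hi.trans (le_abs_self _)).trans h2

end Bounded

section Unbounded

variable {E : Type u} [NormedAddCommGroup E] [InnerProductSpace ℂ E]

/-! ### Resolvents of unbounded self-adjoint operators -/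

lemma IsInverseOfSub.eq {A : E →ₗ.[ℂ] E} {z : ℂ} {R R' : E →L[ℂ] E} (h : IsInverseOfSub A z R)
    (h' : IsInverseOfSub A z R') : R = R' := by
  ext y
  obtain ⟨hy, e⟩ := h.1 y
  have h1 : R' (A ⟨R y, hy⟩ - z • R y) = R y := h'.2 ⟨R y, hy⟩
  rw [← h1, e]

lemma IsInverseOfSub.res_eq {A : E →ₗ.[ℂ] E} {z : ℂ} {R : E →L[ℂ] E}
    (h : IsInverseOfSub A z R) : res A z = R := by
  have hex : ∃ R : E →L[ℂ] E, IsInverseOfSub A z R := ⟨R, h⟩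
  rw [res, dif_pos hex]
  exact hex.choose_spec.eq h

/-- The first resolvent identity. -/
lemma IsInverseOfSub.sub_eq {A : E →ₗ.[ℂ] E} {z w : ℂ} {R R' : E →L[ℂ] E}
    (h : IsInverseOfSub A z R) (h' : IsInverseOfSub A w R') :
    R' = R + (w - z) • (R * R') := by
  ext y
  obtain ⟨hy, e⟩ := h'.1 y
  have h1 := h.2 ⟨R' y, hy⟩
  have h2 : A ⟨R' y, hy⟩ - z • R' y = y + (w - z) • R' y := by
    rw [sub_eq_iff_eq_add.1 e, sub_smul]; abel
  change R _ = R' y at h1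
  change R (A ⟨R' y, hy⟩ - z • R' y) = R' y at h1
  rw [h2] at h1
  simpa using h1.symm

lemma IsInverseOfSub.isCompactOperator {A : E →ₗ.[ℂ] E} {z w : ℂ} {R R' : E →L[ℂ] E}
    (h : IsInverseOfSub A z R) (h' : IsInverseOfSub A w R') (hc : IsCompactOperator R) :
    IsCompactOperator R' := by
  rw [h.sub_eq h']
  exact hc.add ((hc.comp_clm R').smul (w - z))

lemma IsInverseOfSub.injective {A : E →ₗ.[ℂ] E} {z : ℂ} {R : E →L[ℂ] E}
    (h : IsInverseOfSub A z R) : Function.Injective R := by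
  refine (injective_iff_map_eq_zero R).2 fun y hy => ?_
  obtain ⟨hy', e⟩ := h.1 y
  have : (⟨R y, hy'⟩ : A.domain) = 0 := Subtype.ext hy
  rw [← e, this, hy, LinearPMap.map_zero]
  simp

/-- An operator is determined by one resolvent. -/
lemma IsInverseOfSub.operator_eq {A B : E →ₗ.[ℂ] E} {z : ℂ} {R : E →L[ℂ] E}
    (hA : IsInverseOfSub A z R) (hB : IsInverseOfSub B z R) : A = B := by
  have key : ∀ {A B : E →ₗ.[ℂ] E}, IsInverseOfSub A z R → IsInverseOfSub B z R → A ≤ B := by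
    intro A B hA hB
    have hmem : ∀ x : A.domain, (x : E) ∈ B.domain := fun x => by
      rw [← hA.2 x]; exact (hB.1 _).1
    refine ⟨fun x hx => hmem ⟨x, hx⟩, fun x y hxy => ?_⟩
    have h1 := hA.2 x
    have h2 := hB.2 y
    have h3 := hA.injective (h1.trans (hxy.trans h2.symm))
    rw [hxy] at h3
    exact sub_left_injective h3
  exact le_antisymm (key hA hB) (key hB hA)

lemma IsInverseOfSub.mem_graph_of_apply_eq_smul {A : E →ₗ.[ℂ] E} {z c : ℂ} {R : E →L[ℂ] E}
    (h : IsInverseOfSub A z R) {x : E} (hc : c ≠ 0) (hx : R x = c • x) :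
    (x, (c⁻¹ + z) • x) ∈ A.graph := by
  obtain ⟨hd, e⟩ := h.1 x
  have h1 := A.graph.smul_mem c⁻¹ (A.mem_graph ⟨R x, hd⟩)
  have h2 : c⁻¹ • R x = x := by rw [hx, inv_smul_smul₀ hc]
  rw [sub_eq_iff_eq_add.1 e, Prod.smul_mk, smul_add, smul_comm c⁻¹ z, h2, ← add_smul] at h1
  exact h1

variable [CompleteSpace E]

/-- An operator with a symmetric inverse `(A - z)⁻¹` at a real point `z` is self-adjoint: the
adjoint of `A - z` is the inverse of the adjoint of `(A - z)⁻¹`. -/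
lemma IsInverseOfSub.isSelfAdjoint {A : E →ₗ.[ℂ] E} {z : ℝ} {R : E →L[ℂ] E}
    (h : IsInverseOfSub A z R) (hR : ∀ x y, ⟪R x, y⟫_ℂ = ⟪x, R y⟫_ℂ) : IsSelfAdjoint A := by
  have hd : Dense (A.domain : Set E) := by
    rw [Submodule.dense_iff_topologicalClosure_eq_top,
      Submodule.topologicalClosure_eq_top_iff, eq_bot_iff]
    intro y hy
    refine h.injective ?_
    rw [map_zero, ← inner_self_eq_zero (𝕜 := ℂ), hR]
    exact (Submodule.mem_orthogonal' _ _).1 hy _ (h.1 _).1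
  have happ : ∀ x : A.domain, A x = (A x - (z : ℂ) • (x : E)) + (z : ℂ) • (x : E) := fun x => by
    abel
  have hsym : ∀ x y : A.domain, ⟪A x, (y : E)⟫_ℂ = ⟪(x : E), A y⟫_ℂ := fun x y => by
    have h1 := hR (A x - (z : ℂ) • (x : E)) (A y - (z : ℂ) • (y : E))
    rw [h.2, h.2] at h1
    rw [happ x, happ y, inner_add_left, inner_add_right, inner_smul_left, inner_smul_right, h1,
      Complex.conj_ofReal]
  rw [LinearPMap.isSelfAdjoint_def]
  symm
  have hle : A ≤ A.adjoint := LinearPMap.IsFormalAdjoint.le_adjoint hd hsym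
  refine LinearPMap.eq_of_le_of_domain_eq hle (le_antisymm hle.1 fun x hx => ?_)
  have hf := LinearPMap.adjoint_isFormalAdjoint hd ⟨x, hx⟩
  set y := A.adjoint ⟨x, hx⟩
  have : R (y - (z : ℂ) • x) = x := by
    refine ext_inner_right ℂ fun w => ?_
    obtain ⟨hw, e⟩ := h.1 w
    have h2 : ⟪y, R w⟫_ℂ = ⟪x, A ⟨R w, hw⟩⟫_ℂ := hf ⟨R w, hw⟩
    rw [hR, inner_sub_left, h2, inner_smul_left, Complex.conj_ofReal, ← inner_smul_right,
      ← inner_sub_right, e]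
  rw [← this]
  exact (h.1 _).1

lemma inner_apply_left_of_isSelfAdjoint {A : E →ₗ.[ℂ] E} (hA : IsSelfAdjoint A)
    (x y : A.domain) : ⟪A x, (y : E)⟫_ℂ = ⟪(x : E), A y⟫_ℂ := by
  have h := LinearPMap.adjoint_isFormalAdjoint (T := A) hA.dense_domain
  rw [LinearPMap.isSelfAdjoint_def.1 hA] at h
  exact h x y

/-- The resolvent of a self-adjoint operator at a real point is symmetric. -/
lemma IsInverseOfSub.symmetric {A : E →ₗ.[ℂ] E} (hA : IsSelfAdjoint A) {z : ℝ} {R : E →L[ℂ] E}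
    (h : IsInverseOfSub A z R) (x y : E) : ⟪R x, y⟫_ℂ = ⟪x, R y⟫_ℂ := by
  obtain ⟨hx, ex⟩ := h.1 x
  obtain ⟨hy, ey⟩ := h.1 y
  have h1 := inner_apply_left_of_isSelfAdjoint hA ⟨R x, hx⟩ ⟨R y, hy⟩
  change ⟪A ⟨R x, hx⟩, R y⟫_ℂ = ⟪R x, A ⟨R y, hy⟩⟫_ℂ at h1
  conv_lhs => rw [← ey]
  conv_rhs => rw [← ex]
  rw [inner_sub_left, inner_sub_right, h1, inner_smul_left, inner_smul_right, Complex.conj_ofReal]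

lemma IsInverseOfSub.nonneg {A : E →ₗ.[ℂ] E} (hA : IsSelfAdjoint A) {z m : ℝ} {R : E →L[ℂ] E}
    (hm : IsBoundedBelowBy A m) (hz : z ≤ m) (h : IsInverseOfSub A z R) : 0 ≤ R := by
  rw [ContinuousLinearMap.nonneg_iff_isPositive, ContinuousLinearMap.isPositive_def']
  refine ⟨ContinuousLinearMap.isSelfAdjoint_iff_isSymmetric.2 (h.symmetric hA), fun x => ?_⟩
  obtain ⟨hx, ex⟩ := h.1 x
  have h1 := hm ⟨R x, hx⟩
  change m * ‖R x‖ ^ 2 ≤ _ at h1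
  have h2 : (⟪R x, x⟫_ℂ).re = (⟪R x, A ⟨R x, hx⟩⟫_ℂ).re - z * ‖R x‖ ^ 2 := by
    have : ⟪R x, x⟫_ℂ = ⟪R x, A ⟨R x, hx⟩ - (z : ℂ) • R x⟫_ℂ := by rw [ex]
    rw [this, inner_sub_right, inner_smul_right, inner_self_eq_norm_sq_to_K]
    simp [← Complex.ofReal_pow]
  change 0 ≤ (⟪R x, x⟫_ℂ).re
  rw [h2]
  have := mul_le_mul_of_nonneg_right hz (sq_nonneg ‖R x‖)
  change m * ‖R x‖ ^ 2 ≤ (⟪R x, A ⟨R x, hx⟩⟫_ℂ).re at h1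
  linarith

/-- Points below a lower bound of a self-adjoint operator belong to the resolvent set: `A - z` is
bounded below, so its range is closed, and the range is dense since `A` is its own adjoint. -/
lemma exists_isInverseOfSub {A : E →ₗ.[ℂ] E} (hA : IsSelfAdjoint A) {z m : ℝ}
    (hm : IsBoundedBelowBy A m) (hz : z < m) : ∃ R : E →L[ℂ] E, IsInverseOfSub A z R := by
  let L : A.domain →ₗ[ℂ] E := A.toFun - (z : ℂ) • A.domain.subtype
  have hL : ∀ x, L x = A x - (z : ℂ) • (x : E) := fun x => rfl
  have hbd : ∀ x : A.domain, (m - z) * ‖(x : E)‖ ≤ ‖L x‖ := fun x => by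
    have h1 := hm x
    have h2 : (⟪(x : E), L x⟫_ℂ).re = (⟪(x : E), A x⟫_ℂ).re - z * ‖(x : E)‖ ^ 2 := by
      rw [hL, inner_sub_right, inner_smul_right, inner_self_eq_norm_sq_to_K]
      simp [← Complex.ofReal_pow]
    have h3 : (⟪(x : E), L x⟫_ℂ).re ≤ ‖(x : E)‖ * ‖L x‖ := re_inner_le_norm (𝕜 := ℂ) _ _
    rcases (norm_nonneg (x : E)).eq_or_lt with h0 | h0
    · rw [← h0, mul_zero]; positivity
    · refine le_of_mul_le_mul_left ?_ h0
      nlinarith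
  have hpos : 0 < m - z := sub_pos.2 hz
  have hinj : Function.Injective L := by
    refine (injective_iff_map_eq_zero L).2 fun x hx => ?_
    have h1 := hbd x
    rw [hx, norm_zero] at h1
    have : ‖(x : E)‖ ≤ 0 := by nlinarith
    exact Subtype.ext (norm_le_zero_iff.1 this)
  have hclosed : IsClosed (LinearMap.range L : Set E) := by
    refine isClosed_of_closure_subset fun y hy => ?_
    obtain ⟨u, hu, hlim⟩ := mem_closure_iff_seq_limit.1 hy
    choose x hx using hu
    have hcx : CauchySeq fun n => (x n : E) := by
      have hc := hlim.cauchySeq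
      rw [Metric.cauchySeq_iff] at hc ⊢
      intro ε hε
      obtain ⟨N, hN⟩ := hc ((m - z) * ε) (by positivity)
      refine ⟨N, fun i hi j hj => ?_⟩
      have h1 := hN i hi j hj
      rw [dist_eq_norm, ← hx, ← hx, ← map_sub] at h1
      have h2 := (hbd (x i - x j)).trans_lt h1
      rw [dist_eq_norm]
      exact lt_of_mul_lt_mul_left h2 hpos.le
    obtain ⟨x₀, hx₀⟩ := cauchySeq_tendsto_of_complete hcx
    have hAx : Tendsto (fun n => A (x n)) atTop (𝓝 (y + (z : ℂ) • x₀)) := by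
      have : ∀ n, A (x n) = u n + (z : ℂ) • (x n : E) := fun n => by
        rw [← hx, hL]; abel
      simp only [this]
      exact hlim.add (hx₀.const_smul _)
    have hg : (x₀, y + (z : ℂ) • x₀) ∈ A.graph := by
      have hcl : IsClosed (A.graph : Set (E × E)) := hA.isClosed
      refine hcl.mem_of_tendsto (hx₀.prodMk_nhds hAx) (.of_forall fun n => ?_)
      exact A.mem_graph (x n)
    obtain ⟨v, hv1, hv2⟩ := A.mem_graph_iff.1 hg
    refine ⟨v, ?_⟩
    rw [hL, hv2, hv1]
    simp
  have htop : LinearMap.range L = ⊤ := by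
    have hcs : CompleteSpace (LinearMap.range L) := hclosed.completeSpace_coe
    rw [← Submodule.orthogonal_eq_bot_iff, eq_bot_iff]
    intro y hy
    have h1 : ∀ x : A.domain, ⟪y, A x⟫_ℂ = ⟪(z : ℂ) • y, (x : E)⟫_ℂ := fun x => by
      have := (Submodule.mem_orthogonal' _ _).1 hy (L x) ⟨x, rfl⟩
      rw [hL, inner_sub_right, sub_eq_zero, inner_smul_right] at this
      rw [this, inner_smul_left, Complex.conj_ofReal]
    have h2 : y ∈ A.adjoint.domain :=
      LinearPMap.mem_adjoint_domain_of_exists y ⟨(z : ℂ) • y, fun x => (h1 x).symm⟩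
    have h3 : A.adjoint ⟨y, h2⟩ = (z : ℂ) • y :=
      LinearPMap.adjoint_apply_eq hA.dense_domain ⟨y, h2⟩ fun x => (h1 x).symm
    have h4 : ((y, (z : ℂ) • y) : E × E) ∈ A.adjoint.graph := by
      rw [← h3]; exact A.adjoint.mem_graph ⟨y, h2⟩
    rw [LinearPMap.isSelfAdjoint_def.1 hA] at h4
    obtain ⟨v, hv1, hv2⟩ := A.mem_graph_iff.1 h4
    simp only at hv1 hv2
    have h5 : L v = 0 := by rw [hL, hv2, hv1, sub_self]
    have h6 : v = 0 := hinj (h5.trans (map_zero L).symm)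
    rw [← hv1, h6]
    simp
  let e : A.domain ≃ₗ[ℂ] E := LinearEquiv.ofBijective L ⟨hinj, LinearMap.range_eq_top.1 htop⟩
  have he : ∀ x, e x = L x := fun x => rfl
  let R : E →L[ℂ] E := LinearMap.mkContinuous (A.domain.subtype ∘ₗ (e.symm : E →ₗ[ℂ] A.domain))
    (m - z)⁻¹ fun y => by
      have := hbd (e.symm y)
      rw [← he, e.apply_symm_apply] at this
      rw [← div_eq_inv_mul, le_div_iff₀ hpos, mul_comm]
      exact this
  have hR : ∀ y, R y = (e.symm y : E) := fun y => rfl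
  refine ⟨R, fun y => ⟨(e.symm y).2, ?_⟩, fun x => ?_⟩
  · exact e.apply_symm_apply y
  · rw [hR, ← hL, ← he, e.symm_apply_apply]

omit [CompleteSpace E] in
/-- The greatest lower bound is a lower bound; on the zero space, where every real number is one,
this holds trivially. -/
lemma isBoundedBelowBy_lowerBound {A : E →ₗ.[ℂ] E} {m : ℝ} (hm : IsBoundedBelowBy A m) :
    IsBoundedBelowBy A (lowerBound A) := by
  intro x
  rcases eq_or_ne (x : E) 0 with h0 | h0
  · simp [h0]
  · have hx : 0 < ‖(x : E)‖ ^ 2 := by positivity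
    rw [← le_div_iff₀ hx]
    exact csSup_le ⟨m, hm⟩ fun c hc => (le_div_iff₀ hx).2 (hc x)

lemma isInverseOfSub_res_lowerBound {A : E →ₗ.[ℂ] E} (hA : IsSelfAdjoint A) {m : ℝ}
    (hm : IsBoundedBelowBy A m) :
    IsInverseOfSub A ((lowerBound A - 1 : ℝ) : ℂ) (res A ((lowerBound A - 1 : ℝ) : ℂ)) := by
  obtain ⟨R, hR⟩ := exists_isInverseOfSub hA (isBoundedBelowBy_lowerBound hm) (sub_one_lt _)
  rwa [hR.res_eq]

lemma res_lowerBound_nonneg {A : E →ₗ.[ℂ] E} (hA : IsSelfAdjoint A) {m : ℝ}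
    (hm : IsBoundedBelowBy A m) : 0 ≤ res A ((lowerBound A - 1 : ℝ) : ℂ) :=
  (isInverseOfSub_res_lowerBound hA hm).nonneg hA (isBoundedBelowBy_lowerBound hm)
    (sub_one_lt _).le

/-! ### The semigroup -/

/-- The function of the resolvent that gives the semigroup is continuous at the origin too. -/
lemma continuous_expNeg_function {β : ℝ} (hβ : 0 < β) (m : ℝ) :
    Continuous fun r : ℝ => if r ≤ 0 then 0 else Real.exp (-(β * (r⁻¹ + m - 1))) := by
  have : (fun r : ℝ => if r ≤ 0 then 0 else Real.exp (-(β * (r⁻¹ + m - 1)))) =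
      fun r => Real.exp (-(β * (m - 1))) * expNegInvGlue (r / β) := by
    ext r
    rcases le_or_gt r 0 with h | h
    · simp [h, expNegInvGlue.zero_of_nonpos (div_nonpos_of_nonpos_of_nonneg h hβ.le)]
    · have h2 : ¬ r / β ≤ 0 := not_le.2 (div_pos h hβ)
      rw [if_neg (not_le.2 h), expNegInvGlue, if_neg h2, ← Real.exp_add, inv_div]
      congr 1
      ring
  rw [this]
  exact continuous_const.mul
    ((expNegInvGlue.contDiff (n := 0)).continuous.comp (continuous_id.div_const β))

lemma expNeg_nonneg (A : E →ₗ.[ℂ] E) (β : ℝ) : 0 ≤ expNeg A β := by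
  refine cfc_nonneg fun r _ => ?_
  split_ifs
  · exact le_rfl
  · positivity

/-- `e` consists of eigenvectors of `A`, with eigenvalues `l`; being stated in terms of the graph of
`A`, this includes that each `e i` belongs to the domain. -/
def IsEigenbasis (A : E →ₗ.[ℂ] E) {ι : Type*} (e : HilbertBasis ι ℂ E) (l : ι → ℝ) : Prop :=
  ∀ i, (e i, (l i : ℂ) • e i) ∈ A.graph

omit [CompleteSpace E] in
lemma IsInverseOfSub.apply_eigenvector {A : E →ₗ.[ℂ] E} {z l : ℝ} {R : E →L[ℂ] E}
    (h : IsInverseOfSub A z R) {e : E} (he : e ≠ 0) (hg : (e, (l : ℂ) • e) ∈ A.graph) :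
    l - z ≠ 0 ∧ R e = (((l - z)⁻¹ : ℝ) : ℂ) • e := by
  obtain ⟨v, hv1, hv2⟩ := A.mem_graph_iff.1 hg
  simp only at hv1 hv2
  have h1 := h.2 v
  rw [hv2, hv1, ← sub_smul, map_smul] at h1
  have hne : l - z ≠ 0 := by
    intro h0
    rw [← Complex.ofReal_sub, h0, Complex.ofReal_zero, zero_smul] at h1
    exact he h1.symm
  refine ⟨hne, ?_⟩
  rw [← Complex.ofReal_sub] at h1
  rw [Complex.ofReal_inv, eq_inv_smul_iff₀ (by exact_mod_cast hne), h1]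

lemma expNeg_apply_eigenvector {A : E →ₗ.[ℂ] E} (hA : IsSelfAdjoint A) {m : ℝ}
    (hm : IsBoundedBelowBy A m) {β : ℝ} (hβ : 0 < β) {e : E} (he : e ≠ 0) {l : ℝ}
    (hg : (e, (l : ℂ) • e) ∈ A.graph) :
    expNeg A β e = (Real.exp (-(β * l)) : ℂ) • e := by
  have hR := isInverseOfSub_res_lowerBound hA hm
  obtain ⟨-, h2⟩ := hR.apply_eigenvector he hg
  have hl : lowerBound A ≤ l := by
    obtain ⟨v, hv1, hv2⟩ := A.mem_graph_iff.1 hg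
    simp only at hv1 hv2
    have h1 := isBoundedBelowBy_lowerBound hm v
    rw [hv2, hv1, inner_smul_right, inner_self_eq_norm_sq_to_K] at h1
    have hx : 0 < ‖e‖ ^ 2 := by positivity
    refine le_of_mul_le_mul_right (h1.trans_eq ?_) hx
    simp [← Complex.ofReal_pow]
  have hpos : 0 < l - (lowerBound A - 1) := by linarith
  rw [expNeg, cfc_apply_eigenvector (.of_nonneg (res_lowerBound_nonneg hA hm)) he h2
    (continuous_expNeg_function hβ _).continuousOn, if_neg (not_le.2 (inv_pos.2 hpos)), inv_inv]
  congr 4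
  ring

/-- A self-adjoint operator that is bounded below and whose semigroup is of trace class at one
positive time has compact resolvent. -/
lemma isCompactOperator_of_isTraceClass_expNeg {A : E →ₗ.[ℂ] E} (hA : IsSelfAdjoint A) {m : ℝ}
    (hm : IsBoundedBelowBy A m) {β : ℝ} (hβ : 0 < β) (htr : IsTraceClass (expNeg A β)) {z : ℂ}
    {R : E →L[ℂ] E} (hR : IsInverseOfSub A z R) : IsCompactOperator R := by
  have h0 := res_lowerBound_nonneg hA hm
  refine (isInverseOfSub_res_lowerBound hA hm).isCompactOperator hR ?_
  have h1 := isCompactOperator_of_posTrace_ne_top (expNeg_nonneg A β)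
    ((isTraceClass_iff_of_nonneg (expNeg_nonneg A β)).1 htr)
  have h2 := isCompactOperator_cfc_of_isCompactOperator_cfc h0
    (continuous_expNeg_function hβ (lowerBound A)) continuous_id
    (fun r hr => by rw [if_neg (not_le.2 hr)]; positivity) rfl h1
  rwa [cfc_id ℝ _ (.of_nonneg h0)] at h2

/-! ### Operators with compact resolvent -/

/-- A self-adjoint operator that is bounded below and has compact resolvent has an orthonormal
basis of eigenvectors, and its eigenvalues tend to infinity. -/
lemma exists_isEigenbasis {A : E →ₗ.[ℂ] E} (hA : IsSelfAdjoint A) {m : ℝ}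
    (hm : IsBoundedBelowBy A m) {z : ℂ} {R : E →L[ℂ] E} (hR : IsInverseOfSub A z R)
    (hc : IsCompactOperator R) :
    ∃ (ι : Type u) (e : HilbertBasis ι ℂ E) (l : ι → ℝ), IsEigenbasis A e l ∧
      ∀ L, {i | l i ≤ L}.Finite := by
  have h1 := isInverseOfSub_res_lowerBound hA hm
  have h0 := res_lowerBound_nonneg hA hm
  have hc1 := hR.isCompactOperator h1 hc
  set T := res A ((lowerBound A - 1 : ℝ) : ℂ)
  obtain ⟨ι, e, r, her⟩ := exists_hilbertBasis_eigenvectors (.of_nonneg h0) hc1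
  have hr : ∀ i, 0 < r i := fun i => by
    have h2 : 0 ≤ (⟪e i, T (e i)⟫_ℂ).re :=
      ((ContinuousLinearMap.nonneg_iff_isPositive T).1 h0).re_inner_nonneg_right (e i)
    have h3 : (⟪e i, T (e i)⟫_ℂ).re = r i := by
      rw [her, inner_smul_right, inner_self_eq_norm_sq_to_K, e.orthonormal.norm_eq_one]
      simp
    rw [h3] at h2
    refine h2.lt_of_ne fun h4 => e.orthonormal.ne_zero i (h1.injective ?_)
    rw [her, ← h4]
    simp
  refine ⟨ι, e, fun i => (r i)⁻¹ + (lowerBound A - 1), fun i => ?_, fun L => ?_⟩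
  · have h3 := h1.mem_graph_of_apply_eq_smul (by exact_mod_cast (hr i).ne') (her i)
    push_cast at h3 ⊢
    exact h3
  · have hpos : 0 < (|L - (lowerBound A - 1)| + 1)⁻¹ := by positivity
    refine (finite_setOf_le_eigenvalue hc1 e r her hpos).subset fun i hi => ?_
    refine inv_le_of_inv_le₀ (hr i) ?_
    change (r i)⁻¹ + (lowerBound A - 1) ≤ L at hi
    linarith [le_abs_self (L - (lowerBound A - 1))]

lemma posTrace_expNeg_eq_tsum {A : E →ₗ.[ℂ] E} (hA : IsSelfAdjoint A) {m : ℝ}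
    (hm : IsBoundedBelowBy A m) {β : ℝ} (hβ : 0 < β) {ι : Type*} {e : HilbertBasis ι ℂ E}
    {l : ι → ℝ} (he : IsEigenbasis A e l) :
    posTrace (expNeg A β) = ∑' i, ENNReal.ofReal (Real.exp (-(β * l i))) := by
  rw [posTrace_eq_tsum e (expNeg_nonneg A β)]
  refine tsum_congr fun i => ?_
  rw [expNeg_apply_eigenvector hA hm hβ (e.orthonormal.ne_zero i) (he i), inner_smul_right,
    inner_self_eq_norm_sq_to_K, e.orthonormal.norm_eq_one]
  congr 1
  simp [-Complex.ofReal_exp]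

/-- Eigenvectors for `z` are orthogonal to the elements of the basis with other eigenvalues. -/
lemma IsEigenbasis.inner_eq_zero {A : E →ₗ.[ℂ] E} (hA : IsSelfAdjoint A) {ι : Type*}
    {e : HilbertBasis ι ℂ E} {l : ι → ℝ} (he : IsEigenbasis A e l) {z : ℂ} {x : E}
    (hx : (x, z • x) ∈ A.graph) (i : ι) (hi : (l i : ℂ) ≠ z) : ⟪e i, x⟫_ℂ = 0 := by
  obtain ⟨v, hv1, hv2⟩ := A.mem_graph_iff.1 (he i)
  obtain ⟨w, hw1, hw2⟩ := A.mem_graph_iff.1 hx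
  simp only at hv1 hv2 hw1 hw2
  have h := inner_apply_left_of_isSelfAdjoint hA v w
  rw [hv2, hw2, hv1, hw1, inner_smul_left, inner_smul_right, Complex.conj_ofReal, ← sub_eq_zero,
    ← sub_mul] at h
  exact (mul_eq_zero.1 h).resolve_left (sub_ne_zero.2 hi)

/-- If a resolvent `R = (A - w)⁻¹` is compact, the spectrum of `A` consists of eigenvalues:
`A - z = (1 - (z - w) R) (A - w)`, and the Fredholm alternative applies to `R`. -/
lemma IsInverseOfSub.exists_eigenvector_of_mem_spec {A : E →ₗ.[ℂ] E} {w z : ℂ} {R : E →L[ℂ] E}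
    (hR : IsInverseOfSub A w R) (hc : IsCompactOperator R) (hz : z ∈ spec A) :
    ∃ x ≠ 0, (x, z • x) ∈ A.graph := by
  have hzw : z - w ≠ 0 := fun h => hz ⟨R, by rwa [sub_eq_zero.1 h]⟩
  have hmem : (z - w)⁻¹ ∈ spectrum ℂ R := by
    intro hu
    refine hz ?_
    have hu2 : IsUnit (1 - (z - w) • R) := by
      have := hu.smul (Units.mk0 _ hzw)
      convert this using 1
      rw [Units.smul_mk0, smul_sub, Algebra.algebraMap_eq_smul_one, smul_smul,
        mul_inv_cancel₀ hzw, one_smul]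
    obtain ⟨u, hu2⟩ := hu2
    have hcomm : R * (u : E →L[ℂ] E) = u * R := by
      rw [hu2]; simp [mul_sub, sub_mul]
    have hcomm' : R * (↑u⁻¹ : E →L[ℂ] E) = ↑u⁻¹ * R := by
      have hc : Commute R (u : E →L[ℂ] E) := hcomm
      exact hc.units_inv_right
    refine ⟨R * (↑u⁻¹ : E →L[ℂ] E), fun y => ?_, fun x => ?_⟩
    · obtain ⟨hd, h⟩ := hR.1 ((↑u⁻¹ : E →L[ℂ] E) y)
      refine ⟨hd, ?_⟩
      change A ⟨R ((↑u⁻¹ : E →L[ℂ] E) y), hd⟩ - z • R ((↑u⁻¹ : E →L[ℂ] E) y) = y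
      have h2 : ((u : E →L[ℂ] E) * (↑u⁻¹ : E →L[ℂ] E)) y = y := by rw [Units.mul_inv]; rfl
      rw [hu2] at h2
      change (↑u⁻¹ : E →L[ℂ] E) y - (z - w) • R ((↑u⁻¹ : E →L[ℂ] E) y) = y at h2
      rw [sub_eq_iff_eq_add] at h
      rw [h]
      conv_rhs => rw [← h2]
      rw [sub_smul]; abel
    · rw [hcomm']
      change (↑u⁻¹ : E →L[ℂ] E) (R (A x - z • (x : E))) = x
      have h1 : A x - z • (x : E) = (A x - w • (x : E)) - (z - w) • (x : E) := by
        rw [sub_smul]; abel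
      have h2 : R (A x - z • (x : E)) = (u : E →L[ℂ] E) x := by
        rw [h1, map_sub, hR.2, hu2, map_smul]
        rfl
      rw [h2]
      change ((↑u⁻¹ : E →L[ℂ] E) * (u : E →L[ℂ] E)) x = x
      rw [Units.inv_mul]
      rfl
  obtain ⟨x, hx1, hx2⟩ :=
    ((hc.hasEigenvalue_iff_mem_spectrum (inv_ne_zero hzw)).2 hmem).exists_hasEigenvector
  have hx3 : R x = (z - w)⁻¹ • x := Module.End.mem_eigenspace_iff.1 hx1
  refine ⟨x, hx2, ?_⟩
  have h3 := hR.mem_graph_of_apply_eq_smul (inv_ne_zero hzw) hx3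
  rwa [inv_inv, sub_add_cancel] at h3

lemma hasPurelyDiscreteSpectrum {A : E →ₗ.[ℂ] E} (hA : IsSelfAdjoint A) {m : ℝ}
    (hm : IsBoundedBelowBy A m) {w : ℂ} {R : E →L[ℂ] E} (hR : IsInverseOfSub A w R)
    (hc : IsCompactOperator R) : HasPurelyDiscreteSpectrum A := by
  obtain ⟨ι, e, l, he, hfin⟩ := exists_isEigenbasis hA hm hR hc
  have hex : ∀ z ∈ spec A, ∃ i, (l i : ℂ) = z := fun z hz => by
    by_contra! hne
    obtain ⟨x, hx0, hx⟩ := hR.exists_eigenvector_of_mem_spec hc hz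
    have h1 := hasSum_norm_inner_sq e x
    simp only [fun i => he.inner_eq_zero hA hx i (hne i), norm_zero, ne_eq, OfNat.ofNat_ne_zero,
      not_false_eq_true, zero_pow] at h1
    have := h1.unique hasSum_zero
    exact hx0 (norm_eq_zero.1 (pow_eq_zero_iff two_ne_zero |>.1 this))
  intro z hz
  refine ⟨?_, ?_, ?_⟩
  · have hF : ((fun i => (l i : ℂ)) '' {i | l i ≤ z.re + 1} \ {z}).Finite :=
      ((hfin (z.re + 1)).image _).subset Set.sdiff_subset
    obtain ⟨ε, hε, hb⟩ := Metric.isOpen_iff.1 hF.isClosed.isOpen_compl z (by simp)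
    refine ⟨min ε 1, lt_min hε one_pos, fun v hv hvz => ?_⟩
    by_contra! hlt
    obtain ⟨i, rfl⟩ := hex v hv
    refine hb (Metric.mem_ball.2 (hlt.trans_le (min_le_left _ _))) ⟨⟨i, ?_, rfl⟩, hvz⟩
    have h1 : |((l i : ℂ) - z).re| ≤ ‖(l i : ℂ) - z‖ := Complex.abs_re_le_norm _
    rw [← dist_eq_norm] at h1
    have h2 := (le_abs_self _).trans (h1.trans (hlt.le.trans (min_le_right _ _)))
    simp only [Complex.sub_re, Complex.ofReal_re] at h2
    change l i ≤ z.re + 1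
    linarith
  · obtain ⟨x, hx0, hx⟩ := hR.exists_eigenvector_of_mem_spec hc hz
    obtain ⟨v, hv1, hv2⟩ := A.mem_graph_iff.1 hx
    simp only at hv1 hv2
    refine (Submodule.ne_bot_iff _).2 ⟨v, ?_, fun h => hx0 ?_⟩
    · rw [eigenspace, LinearMap.mem_ker]
      change A v - z • (v : E) = 0
      rw [hv2, hv1, sub_self]
    · rw [← hv1, h]; rfl
  · have hS : {i | (l i : ℂ) = z}.Finite := (hfin z.re).subset fun i hi => by
      have : (l i : ℂ) = z := hi
      simp [← this]
    let V := Submodule.span ℂ (e '' {i | (l i : ℂ) = z})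
    have hV : FiniteDimensional ℂ V := FiniteDimensional.span_of_finite ℂ (hS.image _)
    have hmem : ∀ v ∈ eigenspace A z, (v : E) ∈ V := fun v hv => by
      have hv : A v - z • (v : E) = 0 := LinearMap.mem_ker.1 hv
      have hg : ((v : E), z • (v : E)) ∈ A.graph := by
        rw [← sub_eq_zero.1 hv]; exact A.mem_graph v
      have h1 := e.hasSum_repr (v : E)
      refine (Submodule.closed_of_finiteDimensional V).mem_of_tendsto h1
        (.of_forall fun F => V.sum_mem fun i _ => ?_)
      by_cases hi : (l i : ℂ) = z
      · exact V.smul_mem _ (Submodule.subset_span ⟨i, hi, rfl⟩)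
      · rw [e.repr_apply_apply, he.inner_eq_zero hA hg i hi, zero_smul]
        exact V.zero_mem
    let f : eigenspace A z →ₗ[ℂ] V :=
      ((A.domain.subtype).comp (eigenspace A z).subtype).codRestrict V fun v => hmem v v.2
    refine FiniteDimensional.of_injective f fun v w h => ?_
    exact Subtype.ext (Subtype.ext (congrArg (fun t : V => (t : E)) h))

end Unbounded

section Forms

variable {E : Type u} [NormedAddCommGroup E] [InnerProductSpace ℂ E]

/-! ### Sesquilinear forms -/

/-- The Cauchy–Schwarz inequality for a positive semidefinite form. -/
lemma norm_form_sq_le {V : Type*} [AddCommGroup V] [Module ℂ V] (t : V →ₗ⋆[ℂ] V →ₗ[ℂ] ℂ)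
    (hsymm : ∀ x y, t x y = conj (t y x)) (hnn : ∀ x, 0 ≤ (t x x).re) (x y : V) :
    ‖t x y‖ ^ 2 ≤ (t x x).re * (t y y).re := by
  let c : PreInnerProductSpace.Core ℂ V :=
    { inner := fun x y => t x y
      conj_inner_symm := fun x y => (hsymm x y).symm
      re_inner_nonneg := hnn
      add_left := fun x y z => by simp
      smul_left := fun x y r => by simp }
  have h := InnerProductSpace.Core.inner_mul_inner_self_le (c := c) x y
  change ‖t x y‖ * ‖t y x‖ ≤ (t x x).re * (t y y).re at h
  rwa [hsymm y x, RCLike.norm_conj, ← sq] at h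

/-- A bounded Hermitian form that is bounded below by a positive multiple of the norm squared is
the form of a symmetric invertible operator. -/
lemma exists_operator_of_coercive_form [CompleteSpace E] (t : E →ₗ⋆[ℂ] E →ₗ[ℂ] ℂ)
    (hsymm : ∀ x y, t x y = conj (t y x)) {κ C : ℝ} (hκ : 0 < κ)
    (hlow : ∀ x, κ * ‖x‖ ^ 2 ≤ (t x x).re) (hup : ∀ x, (t x x).re ≤ C * ‖x‖ ^ 2) :
    ∃ M : (E →L[ℂ] E)ˣ, (∀ x y, t x y = ⟪(M : E →L[ℂ] E) x, y⟫_ℂ) ∧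
      ∀ x y, ⟪(M : E →L[ℂ] E) x, y⟫_ℂ = ⟪x, (M : E →L[ℂ] E) y⟫_ℂ := by
  have hnn : ∀ x, 0 ≤ (t x x).re := fun x => le_trans (by positivity) (hlow x)
  have hbd : ∀ x y, ‖t x y‖ ≤ |C| * ‖x‖ * ‖y‖ := fun x y => by
    have hup' : ∀ x, (t x x).re ≤ |C| * ‖x‖ ^ 2 := fun x => (hup x).trans <|
      mul_le_mul_of_nonneg_right (le_abs_self C) (by positivity)
    refine le_of_sq_le_sq ?_ (by positivity)
    refine (norm_form_sq_le t hsymm hnn x y).trans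
      ((mul_le_mul (hup' x) (hup' y) (hnn y) (by positivity)).trans_eq (by ring))
  let M := InnerProductSpace.continuousLinearMapOfBilin (t.mkContinuous₂ |C| hbd)
  have hM : ∀ x y, t x y = ⟪M x, y⟫_ℂ := fun x y =>
    (InnerProductSpace.continuousLinearMapOfBilin_apply (t.mkContinuous₂ |C| hbd) x y).symm
  have hu : IsUnit M := by
    refine M.isUnit_of_forall_le_norm_inner_map (c := ⟨κ, hκ.le⟩) hκ fun x => ?_
    rw [← hM, mul_comm]
    exact (hlow x).trans (Complex.re_le_norm _)
  obtain ⟨u, hu⟩ := hu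
  refine ⟨u, fun x y => by rw [hu, hM], fun x y => ?_⟩
  rw [hu, ← hM, hsymm, hM, inner_conj_symm]

/-- Bessel's inequality in the norm of a form `q + c ≥ 0`: the eigenvectors of the operator of `q`
are orthogonal for `q`, too. -/
lemma sum_le_form {Q : Submodule ℂ E} (q : Q →ₗ⋆[ℂ] Q →ₗ[ℂ] ℂ)
    (hsymm : ∀ x y, q x y = conj (q y x)) {c : ℝ}
    (hnn : ∀ x : Q, 0 ≤ (q x x).re + c * ‖(x : E)‖ ^ 2)
    {ι : Type*} {e : ι → Q} (he : Orthonormal ℂ fun i => (e i : E)) {l : ι → ℝ}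
    (hl : ∀ i (x : Q), q x (e i) = l i * ⟪(x : E), e i⟫_ℂ) (F : Finset ι) (x : Q) :
    ∑ i ∈ F, (l i + c) * ‖⟪(e i : E), x⟫_ℂ‖ ^ 2 ≤ (q x x).re + c * ‖(x : E)‖ ^ 2 := by
  set s : ℝ := ∑ i ∈ F, (l i + c) * ‖⟪(e i : E), x⟫_ℂ‖ ^ 2 with hs
  set y : Q := ∑ i ∈ F, ⟪(e i : E), x⟫_ℂ • e i with hy
  have hyE : (y : E) = ∑ i ∈ F, ⟪(e i : E), x⟫_ℂ • (e i : E) := by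
    rw [hy]; push_cast; rfl
  have hexp : ∀ w : Q, (∀ i ∈ F, ⟪(w : E), e i⟫_ℂ = ⟪(x : E), e i⟫_ℂ) →
      q w y + c * ⟪(w : E), y⟫_ℂ = s := fun w hw => by
    rw [hyE, hy, map_sum, inner_sum, Finset.mul_sum, ← Finset.sum_add_distrib, hs,
      Complex.ofReal_sum]
    refine Finset.sum_congr rfl fun i hi => ?_
    rw [map_smul, hl, inner_smul_right, hw i hi, smul_eq_mul, ← inner_conj_symm (x : E) (e i : E)]
    have := Complex.mul_conj ⟪(e i : E), x⟫_ℂ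
    rw [Complex.normSq_eq_norm_sq] at this
    push_cast at this ⊢
    rw [← this]
    ring
  have h1 := hexp x fun _ _ => rfl
  have h2 := hexp y fun i hi => by
    rw [hyE, he.inner_left_sum _ hi, inner_conj_symm]
  have h3 := congrArg conj h1
  rw [map_add, ← hsymm, map_mul, inner_conj_symm, Complex.conj_ofReal, Complex.conj_ofReal] at h3
  have h4 := hnn (x - y)
  have h5 : ((q (x - y) (x - y)).re + c * ‖((x - y : Q) : E)‖ ^ 2 : ℝ) =
      (q (x - y) (x - y) + c * ⟪((x - y : Q) : E), ((x - y : Q) : E)⟫_ℂ).re := by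
    rw [inner_self_eq_norm_sq_to_K]
    simp [← Complex.ofReal_pow]
  have h6 : ((q x x).re + c * ‖(x : E)‖ ^ 2 : ℝ) = (q x x + c * ⟪(x : E), (x : E)⟫_ℂ).re := by
    rw [inner_self_eq_norm_sq_to_K]
    simp [← Complex.ofReal_pow]
  have h7 : q (x - y) (x - y) + c * ⟪((x - y : Q) : E), ((x - y : Q) : E)⟫_ℂ =
      (q x x + c * ⟪(x : E), (x : E)⟫_ℂ) - (q x y + c * ⟪(x : E), (y : E)⟫_ℂ) -
        (q y x + c * ⟪(y : E), (x : E)⟫_ℂ) + (q y y + c * ⟪(y : E), (y : E)⟫_ℂ) := by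
    rw [Submodule.coe_sub, inner_sub_left, inner_sub_right, inner_sub_right, map_sub, map_sub,
      LinearMap.sub_apply, LinearMap.sub_apply]
    ring
  rw [h5, h7, h1, h2, h3] at h4
  rw [h6]
  simp only [Complex.add_re, Complex.sub_re, Complex.ofReal_re] at h4 ⊢
  linarith

variable [CompleteSpace E]

/-! ### The form domain of a positive self-adjoint operator -/

lemma form_self_re (A : E →ₗ.[ℂ] E) (ψ : formDomain A) :
    (form A ψ ψ).re = ‖sqrtOp A ψ‖ ^ 2 := by
  change (⟪sqrtOp A ψ, sqrtOp A ψ⟫_ℂ).re = _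
  rw [inner_self_eq_norm_sq_to_K]
  simp [← Complex.ofReal_pow]

lemma form_symm (A : E →ₗ.[ℂ] E) (ψ φ : formDomain A) : form A ψ φ = conj (form A φ ψ) :=
  (inner_conj_symm _ _).symm

/-- With `B = (A + 1)⁻¹`, the operator `S = B^{1/2}` maps the whole space bijectively onto the form
domain of `A`, and `⟨A^{1/2} S g, A^{1/2} S h⟩ = ⟨g, (1 - B) h⟩`. -/
lemma exists_formDomain_equiv {A : E →ₗ.[ℂ] E} (hA : IsSelfAdjoint A)
    (hpos : IsBoundedBelowBy A 0) :
    ∃ (S : E →L[ℂ] E) (σ : E ≃ₗ[ℂ] formDomain A), (∀ g, (σ g : E) = S g) ∧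
      IsInverseOfSub A (-1) (S * S) ∧ (∀ x y, ⟪S x, y⟫_ℂ = ⟪x, S y⟫_ℂ) ∧
      (∀ g h, form A (σ g) (σ h) = ⟪g, h⟫_ℂ - ⟪S g, S h⟫_ℂ) ∧
      (IsCompactOperator (S * S : E →L[ℂ] E) → IsCompactOperator S) := by
  obtain ⟨B, hB⟩ := exists_isInverseOfSub hA hpos (z := -1) (by norm_num)
  have hB0 : 0 ≤ B := hB.nonneg hA hpos (by norm_num)
  have hBsa : IsSelfAdjoint B := .of_nonneg hB0
  have hB1 : ‖B‖ ≤ 1 := by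
    refine B.opNorm_le_bound zero_le_one fun x => ?_
    obtain ⟨hd, hx⟩ := hB.1 x
    have h1 : 0 ≤ (⟪B x, A ⟨B x, hd⟩⟫_ℂ).re := by simpa using hpos ⟨B x, hd⟩
    have h2 : ⟪B x, x⟫_ℂ = ⟪B x, A ⟨B x, hd⟩ - ((-1 : ℝ) : ℂ) • B x⟫_ℂ := by rw [hx]
    have h3 : (⟪B x, x⟫_ℂ).re = (⟪B x, A ⟨B x, hd⟩⟫_ℂ).re + ‖B x‖ ^ 2 := by
      rw [h2, inner_sub_right, inner_smul_right, inner_self_eq_norm_sq_to_K]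
      simp [← Complex.ofReal_pow]
    have h4 : (⟪B x, x⟫_ℂ).re ≤ ‖B x‖ * ‖x‖ := re_inner_le_norm (𝕜 := ℂ) _ _
    rw [one_mul]
    rcases (norm_nonneg (B x)).eq_or_lt with h0 | h0
    · rw [← h0]; positivity
    · refine le_of_mul_le_mul_left ?_ h0
      nlinarith
  have hspec : ∀ r ∈ spectrum ℝ B, 0 ≤ r ∧ r ≤ 1 := fun r hr => by
    refine ⟨spectrum_nonneg_of_nonneg hB0 hr, ?_⟩
    refine (le_abs_self r).trans ((spectrum.norm_le_norm_mul_of_mem hr).trans ?_)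
    exact (mul_le_mul hB1 ContinuousLinearMap.norm_id_le (norm_nonneg _) zero_le_one).trans_eq
      (one_mul 1)
  have hres : res A (-1) = B := by
    have := hB.res_eq
    push_cast at this
    exact this
  set S : E →L[ℂ] E := cfc Real.sqrt B with hS
  set N : E →L[ℂ] E := cfc (fun r : ℝ => √(1 - r)) B with hN
  have hSS : S * S = B := by
    rw [hS, ← cfc_mul Real.sqrt Real.sqrt B]
    conv_rhs => rw [← cfc_id' ℝ B]
    exact cfc_congr fun r hr => Real.mul_self_sqrt (hspec r hr).1
  have hNN : N * N = 1 - B := by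
    have h1 : cfc (fun r : ℝ => 1 - r) B = 1 - B := by
      rw [cfc_sub (fun _ : ℝ => (1 : ℝ)) (fun r => r) B, cfc_const_one ℝ B, cfc_id' ℝ B]
    rw [hN, ← cfc_mul _ _ B, ← h1]
    exact cfc_congr fun r hr => Real.mul_self_sqrt (sub_nonneg.2 (hspec r hr).2)
  have hSsym : ∀ x y, ⟪S x, y⟫_ℂ = ⟪x, S y⟫_ℂ :=
    (cfc_predicate Real.sqrt B : IsSelfAdjoint S).isSymmetric
  have hNsym : ∀ x y, ⟪N x, y⟫_ℂ = ⟪x, N y⟫_ℂ :=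
    (cfc_predicate (fun r : ℝ => √(1 - r)) B : IsSelfAdjoint N).isSymmetric
  have hSinj : Function.Injective S := by
    refine Function.Injective.of_comp (f := S) ?_
    have : S ∘ S = B := by rw [← hSS]; rfl
    rw [this]
    exact hB.injective
  have hker : LinearMap.ker
      ((((cfc Real.sqrt (res A (-1)) : E →L[ℂ] E) : E →ₗ[ℂ] E).toPMap ⊤).toFun) = ⊥ := by
    rw [hres, LinearMap.ker_eq_bot]
    exact fun x y h => Subtype.ext (hSinj h)
  have hdom : formDomain A = LinearMap.range (S : E →ₗ[ℂ] E) := by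
    change (((cfc Real.sqrt (res A (-1)) : E →L[ℂ] E) : E →ₗ[ℂ] E).toPMap ⊤).inverse.domain = _
    rw [hres, LinearPMap.inverse_domain]
    ext x
    exact ⟨fun ⟨y, hy⟩ => ⟨y, hy⟩, fun ⟨y, hy⟩ => ⟨⟨y, trivial⟩, hy⟩⟩
  let σ₀ : E →ₗ[ℂ] formDomain A := (S : E →ₗ[ℂ] E).codRestrict _ fun g => by
    rw [hdom]; exact ⟨g, rfl⟩
  have hσ₀ : ∀ g, (σ₀ g : E) = S g := fun g => rfl
  have hbij : Function.Bijective σ₀ := by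
    refine ⟨fun g h hgh => hSinj (congrArg (fun t : formDomain A => (t : E)) hgh), fun ψ => ?_⟩
    have h : ∀ x, x ∈ formDomain A → x ∈ LinearMap.range (S : E →ₗ[ℂ] E) := fun x hx => hdom ▸ hx
    obtain ⟨g, hg⟩ := h _ ψ.2
    exact ⟨g, Subtype.ext hg⟩
  have hsq : ∀ g, sqrtOp A (σ₀ g) = N g := fun g => by
    have h1 : (((cfc Real.sqrt (res A (-1)) : E →L[ℂ] E) : E →ₗ[ℂ] E).toPMap ⊤).inverse (σ₀ g) =
        g := by
      refine LinearPMap.inverse_apply_eq hker (x := ⟨g, trivial⟩) ?_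
      change (cfc Real.sqrt (res A (-1)) : E →L[ℂ] E) g = S g
      rw [hres]
    change (cfc (fun r : ℝ => √(1 - r)) (res A (-1)) : E →L[ℂ] E)
      ((((cfc Real.sqrt (res A (-1)) : E →L[ℂ] E) : E →ₗ[ℂ] E).toPMap ⊤).inverse (σ₀ g)) = _
    rw [h1, hres]
  refine ⟨S, LinearEquiv.ofBijective σ₀ hbij, hσ₀, ?_, hSsym, fun g h => ?_, fun hc => ?_⟩
  · rw [hSS]
    push_cast at hB
    exact hB
  · change ⟪sqrtOp A (σ₀ g), sqrtOp A (σ₀ h)⟫_ℂ = _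
    rw [hsq, hsq, hNsym, hSsym]
    change ⟪g, (N * N) h⟫_ℂ = _ - ⟪g, (S * S) h⟫_ℂ
    rw [hNN, hSS, ← inner_sub_right]
    rfl
  · rw [hSS] at hc
    refine isCompactOperator_cfc_of_isCompactOperator_cfc hB0 continuous_id Real.continuous_sqrt
      (fun r hr => hr) Real.sqrt_zero ?_
    rwa [cfc_id ℝ B hBsa]

/-! ### Perturbation of the form -/

/-- `X` is a symmetric form on the form domain of `A` that is bounded relative to the form of `A`,
with relative bound `a < 1`. The constant `b` may be negative. -/
structure IsFormBounded (A : E →ₗ.[ℂ] E) (X : formDomain A →ₗ⋆[ℂ] formDomain A →ₗ[ℂ] ℂ)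
    (a b : ℝ) : Prop where
  symm : ∀ φ ψ, X φ ψ = conj (X ψ φ)
  nonneg : 0 ≤ a
  lt_one : a < 1
  bound : ∀ ψ : formDomain A, ‖X ψ ψ‖ ≤ a * (form A ψ ψ).re + b * ‖(ψ : E)‖ ^ 2

lemma IsFormBounded.zero (A : E →ₗ.[ℂ] E) : IsFormBounded A 0 0 0 where
  symm := by simp
  nonneg := le_rfl
  lt_one := one_pos
  bound := by simp

variable {A : E →ₗ.[ℂ] E} {X : formDomain A →ₗ⋆[ℂ] formDomain A →ₗ[ℂ] ℂ} {a b : ℝ}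

lemma IsFormBounded.symm_add (hX : IsFormBounded A X a b) (φ ψ : formDomain A) :
    (form A + X) φ ψ = conj ((form A + X) ψ φ) := by
  simp only [LinearMap.add_apply, map_add]
  rw [form_symm A φ ψ, hX.symm φ ψ]

lemma IsFormBounded.le_add (hX : IsFormBounded A X a b) (ψ : formDomain A) :
    (1 - a) * (form A ψ ψ).re - b * ‖(ψ : E)‖ ^ 2 ≤ ((form A + X) ψ ψ).re := by
  have h1 := (abs_le.1 ((Complex.abs_re_le_norm _).trans (hX.bound ψ))).1
  simp only [LinearMap.add_apply, Complex.add_re]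
  linarith

lemma IsFormBounded.add_le (hX : IsFormBounded A X a b) (ψ : formDomain A) :
    ((form A + X) ψ ψ).re ≤ (1 + a) * (form A ψ ψ).re + b * ‖(ψ : E)‖ ^ 2 := by
  have h1 := (abs_le.1 ((Complex.abs_re_le_norm _).trans (hX.bound ψ))).2
  simp only [LinearMap.add_apply, Complex.add_re]
  linarith

lemma IsFormBounded.add_nonneg (hX : IsFormBounded A X a b) (ψ : formDomain A) :
    0 ≤ ((form A + X) ψ ψ).re + b * ‖(ψ : E)‖ ^ 2 := by
  have h1 := hX.le_add ψ
  have h2 : 0 ≤ (1 - a) * (form A ψ ψ).re := by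
    rw [form_self_re]
    exact mul_nonneg (sub_nonneg.2 hX.lt_one.le) (by positivity)
  linarith

lemma perturbed_graph (hA : IsSelfAdjoint A) (hpos : IsBoundedBelowBy A 0)
    (X : formDomain A →ₗ⋆[ℂ] formDomain A →ₗ[ℂ] ℂ) :
    (perturbed A X).graph = formGraph (formDomain A) (form A + X) := by
  refine Submodule.toLinearPMap_graph_eq _ ?_
  rintro ⟨x, y⟩ ⟨hx, hxy⟩ (rfl : x = 0)
  obtain ⟨S, σ, hσ, -, hS, -, -⟩ := exists_formDomain_equiv hA hpos
  have h1 : ∀ g, ⟪g, S y⟫_ℂ = 0 := fun g => by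
    have h2 := hxy (σ g)
    have h3 : (⟨0, hx⟩ : formDomain A) = 0 := rfl
    rw [h3, map_zero, hσ, hS] at h2
    exact h2.symm
  have h2 : S y = 0 := by simpa using h1 (S y)
  have h3 : σ y = 0 := Subtype.ext ((hσ y).trans h2)
  exact σ.map_eq_zero_iff.1 h3

lemma IsFormBounded.isBoundedBelowBy_perturbed (hA : IsSelfAdjoint A)
    (hpos : IsBoundedBelowBy A 0) (hX : IsFormBounded A X a b) :
    IsBoundedBelowBy (perturbed A X) (-b) := by
  intro x
  have h1 := (perturbed A X).mem_graph x
  rw [perturbed_graph hA hpos] at h1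
  obtain ⟨hx, h⟩ := h1
  have h2 := h ⟨x, hx⟩
  have h3 := hX.add_nonneg ⟨x, hx⟩
  change _ = ⟪(x : E), perturbed A X x⟫_ℂ at h2
  rw [← h2]
  linarith

/-- The **KLMN theorem**, with the resolvent of the perturbed operator: it is `S M⁻¹ S` for
`S = (A + 1)^{-1/2}` and the operator `M` with `⟨g, M h⟩ = (q + X + b + 1)(S g, S h)`, so that it
is compact if the resolvent of `A` is. -/
lemma IsFormBounded.exists_isInverseOfSub_perturbed (hA : IsSelfAdjoint A)
    (hpos : IsBoundedBelowBy A 0) (hX : IsFormBounded A X a b) :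
    ∃ R : E →L[ℂ] E, IsInverseOfSub (perturbed A X) ((-(b + 1) : ℝ) : ℂ) R ∧
      (∀ x y, ⟪R x, y⟫_ℂ = ⟪x, R y⟫_ℂ) ∧
      ∀ B : E →L[ℂ] E, IsInverseOfSub A (-1) B → IsCompactOperator B → IsCompactOperator R := by
  obtain ⟨S, σ, hσ, hSS, hS, hform, hScomp⟩ := exists_formDomain_equiv hA hpos
  let t : E →ₗ⋆[ℂ] E →ₗ[ℂ] ℂ := LinearMap.mk₂'ₛₗ _ _
    (fun g h => (form A + X) (σ g) (σ h) + ((b + 1 : ℝ) : ℂ) * ⟪S g, S h⟫_ℂ)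
    (fun g g' h => by simp only [map_add, LinearMap.add_apply, inner_add_left]; ring)
    (fun c g h => by
      simp only [map_smul, LinearMap.map_smulₛₗ, LinearMap.smul_apply, inner_smul_left, smul_eq_mul]
      ring)
    (fun g h h' => by simp only [map_add, inner_add_right]; ring)
    (fun c g h => by
      simp only [map_smul, inner_smul_right, smul_eq_mul, RingHom.id_apply]
      ring)
  have ht : ∀ g h, t g h = (form A + X) (σ g) (σ h) + ((b + 1 : ℝ) : ℂ) * ⟪S g, S h⟫_ℂ :=
    fun g h => rfl
  have htsymm : ∀ g h, t g h = conj (t h g) := fun g h => by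
    rw [ht, ht, map_add, ← hX.symm_add, map_mul, inner_conj_symm, Complex.conj_ofReal]
  have hSre : ∀ g, (form A (σ g) (σ g)).re = ‖g‖ ^ 2 - ‖S g‖ ^ 2 := fun g => by
    rw [hform, inner_self_eq_norm_sq_to_K, inner_self_eq_norm_sq_to_K]
    simp [← Complex.ofReal_pow]
  have hSnorm : ∀ g, ‖S g‖ ^ 2 ≤ ‖g‖ ^ 2 := fun g => by
    have h1 := hSre g
    rw [form_self_re] at h1
    have : 0 ≤ ‖sqrtOp A (σ g)‖ ^ 2 := by positivity
    linarith
  have htre : ∀ g, (t g g).re = ((form A + X) (σ g) (σ g)).re + (b + 1) * ‖S g‖ ^ 2 := fun g => by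
    rw [ht, inner_self_eq_norm_sq_to_K]
    simp [← Complex.ofReal_pow, -Complex.ofReal_add]
  have ha0 := hX.nonneg
  have ha1 := hX.lt_one
  -- the shift `b + 1` is chosen so that `t` is at least `(1 - a) (‖g‖² - ‖S g‖²) + ‖S g‖²`
  obtain ⟨M, hM, hMsym⟩ := exists_operator_of_coercive_form t htsymm (κ := 1 - a)
    (C := 1 + a + |2 * b + 1|) (by linarith)
    (fun g => by
      have h1 := hX.le_add (σ g)
      rw [hSre, hσ] at h1
      rw [htre]
      have h2 : 0 ≤ a * ‖S g‖ ^ 2 := by positivity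
      linarith)
    (fun g => by
      have h1 := hX.add_le (σ g)
      rw [hSre, hσ] at h1
      rw [htre]
      have h2 : (2 * b + 1) * ‖S g‖ ^ 2 ≤ |2 * b + 1| * ‖g‖ ^ 2 :=
        mul_le_mul (le_abs_self _) (hSnorm g) (by positivity) (abs_nonneg _)
      have h3 : 0 ≤ (1 + a) * ‖S g‖ ^ 2 := by positivity
      linarith)
  have hMi : ∀ y, (M : E →L[ℂ] E) ((↑M⁻¹ : E →L[ℂ] E) y) = y := fun y => by
    rw [← mul_apply_eq_comp, Units.mul_inv]; rfl
  have hMi' : ∀ y, (↑M⁻¹ : E →L[ℂ] E) ((M : E →L[ℂ] E) y) = y := fun y => by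
    rw [← mul_apply_eq_comp, Units.inv_mul]; rfl
  have hMisym : ∀ x y, ⟪(↑M⁻¹ : E →L[ℂ] E) x, y⟫_ℂ = ⟪x, (↑M⁻¹ : E →L[ℂ] E) y⟫_ℂ := fun x y => by
    have := hMsym ((↑M⁻¹ : E →L[ℂ] E) x) ((↑M⁻¹ : E →L[ℂ] E) y)
    rw [hMi, hMi] at this
    exact this.symm
  let R : E →L[ℂ] E := S * (↑M⁻¹ : E →L[ℂ] E) * S
  have hR : ∀ y, R y = S ((↑M⁻¹ : E →L[ℂ] E) (S y)) := fun y => rfl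
  refine ⟨R, ⟨fun y => ?_, fun x => ?_⟩, fun x y => ?_, fun B hB hc => ?_⟩
  · set k := (↑M⁻¹ : E →L[ℂ] E) (S y) with hk
    have hg : (R y, y - ((b + 1 : ℝ) : ℂ) • R y) ∈ (perturbed A X).graph := by
      rw [perturbed_graph hA hpos]
      refine ⟨by rw [hR, ← hσ]; exact (σ _).2, fun ψ => ?_⟩
      obtain ⟨g, rfl⟩ := σ.surjective ψ
      have h1 : (⟨R y, by rw [hR, ← hσ]; exact (σ _).2⟩ : formDomain A) = σ k :=
        Subtype.ext (hσ k).symm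
      rw [h1]
      have h2 := ht g k
      rw [hM, hMsym, hk, hMi, ← hS, ← hk] at h2
      rw [hσ, inner_sub_right, inner_smul_right, hR, h2]
      ring
    obtain ⟨v, hv1, hv2⟩ := (perturbed A X).mem_graph_iff.1 hg
    simp only at hv1 hv2
    have hd : R y ∈ (perturbed A X).domain := hv1 ▸ v.2
    refine ⟨hd, ?_⟩
    have : v = ⟨R y, hd⟩ := Subtype.ext hv1
    rw [← this, hv2]
    push_cast
    module
  · have hg := (perturbed A X).mem_graph x
    rw [perturbed_graph hA hpos] at hg
    obtain ⟨hx, hg⟩ := hg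
    obtain ⟨k, hk⟩ := σ.surjective ⟨x, hx⟩
    have hkx : S k = x := by rw [← hσ, hk]
    have hMk : (M : E →L[ℂ] E) k = S (perturbed A X x - ((-(b + 1) : ℝ) : ℂ) • (x : E)) := by
      refine ext_inner_left ℂ fun g => ?_
      have h1 := hg (σ g)
      change _ = ⟪(σ g : E), perturbed A X x⟫_ℂ at h1
      rw [← hMsym, ← hM, ht, hk, h1, hkx, hσ, ← hS, inner_sub_right,
        inner_smul_right]
      push_cast
      ring
    rw [hR, ← hMk, hMi', hkx]
  · rw [hR, hR, hS, hMisym, hS]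
  · rw [hB.eq hSS] at hc
    exact (hScomp hc).clm_comp (S * (↑M⁻¹ : E →L[ℂ] E))

/-- A positive self-adjoint operator is the operator of its form. -/
lemma perturbed_zero (hA : IsSelfAdjoint A) (hpos : IsBoundedBelowBy A 0) :
    perturbed A 0 = A := by
  obtain ⟨S, σ, hσ, hSS, hS, hform, -⟩ := exists_formDomain_equiv hA hpos
  obtain ⟨R, hR, -, -⟩ := (IsFormBounded.zero A).exists_isInverseOfSub_perturbed hA hpos
  norm_num at hR
  suffices R = S * S by
    rw [this] at hR
    exact hR.operator_eq hSS
  ext y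
  have hg : (S (S y), y - S (S y)) ∈ (perturbed A 0).graph := by
    rw [perturbed_graph hA hpos]
    refine ⟨by rw [← hσ]; exact (σ _).2, fun ψ => ?_⟩
    obtain ⟨g, rfl⟩ := σ.surjective ψ
    have h1 : (⟨S (S y), by rw [← hσ]; exact (σ _).2⟩ : formDomain A) = σ (S y) :=
      Subtype.ext (hσ _).symm
    simp only [h1, add_zero]
    rw [hform, hσ, inner_sub_right, ← hS]
  obtain ⟨v, hv1, hv2⟩ := (perturbed A 0).mem_graph_iff.1 hg
  simp only at hv1 hv2
  have h1 := hR.2 v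
  rw [hv1, hv2] at h1
  simpa using h1

variable {Y : formDomain A →ₗ⋆[ℂ] formDomain A →ₗ[ℂ] ℂ} {a' b' : ℝ}

lemma IsFormBounded.isSelfAdjoint_perturbed (hA : IsSelfAdjoint A)
    (hpos : IsBoundedBelowBy A 0) (hX : IsFormBounded A X a b) :
    IsSelfAdjoint (perturbed A X) := by
  obtain ⟨R, hR, hsymm, -⟩ := hX.exists_isInverseOfSub_perturbed hA hpos
  exact hR.isSelfAdjoint hsymm

/-! ### Comparison of traces -/

/-- An eigenbasis of the perturbed operator, with the eigenvalue equation in terms of the form. -/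
lemma IsFormBounded.exists_isEigenbasis_perturbed (hA : IsSelfAdjoint A)
    (hpos : IsBoundedBelowBy A 0) (hX : IsFormBounded A X a b) {B : E →L[ℂ] E}
    (hB : IsInverseOfSub A (-1) B) (hc : IsCompactOperator B) :
    ∃ (ι : Type u) (e : HilbertBasis ι ℂ E) (l : ι → ℝ), IsEigenbasis (perturbed A X) e l ∧
      ∃ f : ι → formDomain A, (∀ i, (f i : E) = e i) ∧
        ∀ i ψ, (form A + X) ψ (f i) = l i * ⟪(ψ : E), e i⟫_ℂ := by
  obtain ⟨R, hR, -, hRc⟩ := hX.exists_isInverseOfSub_perturbed hA hpos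
  obtain ⟨ι, e, l, he, -⟩ := exists_isEigenbasis (hX.isSelfAdjoint_perturbed hA hpos)
    (hX.isBoundedBelowBy_perturbed hA hpos) hR (hRc B hB hc)
  have h : ∀ i, (e i, (l i : ℂ) • e i) ∈ formGraph (formDomain A) (form A + X) := fun i => by
    rw [← perturbed_graph hA hpos]; exact he i
  choose hmem hf using h
  refine ⟨ι, e, l, he, fun i => ⟨e i, hmem i⟩, fun i => rfl, fun i ψ => ?_⟩
  rw [← inner_smul_right]
  exact hf i ψ

/-- Jensen's inequality: `exp (-β q(ψ, ψ)) ≤ ⟨ψ, exp (-β H) ψ⟩` for a unit vector `ψ` in the form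
domain, where `q` is the form of `H`. -/
lemma IsFormBounded.exp_neg_form_le (hA : IsSelfAdjoint A) (hpos : IsBoundedBelowBy A 0)
    (hX : IsFormBounded A X a b) {B : E →L[ℂ] E} (hB : IsInverseOfSub A (-1) B)
    (hc : IsCompactOperator B) {β : ℝ} (hβ : 0 < β) {ψ : formDomain A} (hψ : ‖(ψ : E)‖ = 1) :
    Real.exp (-(β * ((form A + X) ψ ψ).re)) ≤
      (⟪(ψ : E), expNeg (perturbed A X) β ψ⟫_ℂ).re := by
  obtain ⟨ι, e, l, he, f, hfe, hf⟩ := hX.exists_isEigenbasis_perturbed hA hpos hB hc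
  set T := expNeg (perturbed A X) β
  set x : ℝ := ((form A + X) ψ ψ).re
  have hT : ∀ i, T (e i) = (Real.exp (-(β * l i)) : ℂ) • e i := fun i =>
    expNeg_apply_eigenvector (hX.isSelfAdjoint_perturbed hA hpos)
      (hX.isBoundedBelowBy_perturbed hA hpos) hβ (e.orthonormal.ne_zero i) (he i)
  have hTsym : ∀ x y, ⟪T x, y⟫_ℂ = ⟪x, T y⟫_ℂ :=
    (IsSelfAdjoint.of_nonneg (expNeg_nonneg (perturbed A X) β)).isSymmetric
  have h1 : HasSum (fun i => Real.exp (-(β * l i)) * ‖⟪e i, (ψ : E)⟫_ℂ‖ ^ 2)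
      (⟪(ψ : E), T ψ⟫_ℂ).re := by
    convert Complex.hasSum_re (e.hasSum_inner_mul_inner (ψ : E) (T ψ)) using 1
    ext i
    rw [← hTsym, hT, inner_smul_left, ← inner_conj_symm (ψ : E) (e i), mul_left_comm,
      ← Complex.normSq_eq_conj_mul_self, Complex.normSq_eq_norm_sq, Complex.conj_ofReal,
      ← Complex.ofReal_mul, Complex.ofReal_re]
  have h2 : HasSum (fun i => ‖⟪e i, (ψ : E)⟫_ℂ‖ ^ 2) 1 := by
    simpa [hψ] using hasSum_norm_inner_sq e (ψ : E)
  have hon : Orthonormal ℂ fun i => (f i : E) := by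
    simp only [hfe]; exact e.orthonormal
  have h3 : ∀ F : Finset ι, ∑ i ∈ F, (l i + b) * ‖⟪e i, (ψ : E)⟫_ℂ‖ ^ 2 ≤ x + b := fun F => by
    have := sum_le_form (form A + X) hX.symm_add hX.add_nonneg hon
      (fun i φ => by rw [hf, hfe]) F ψ
    simp only [hfe, hψ, one_pow, mul_one] at this
    exact this
  -- the tangent of the exponential at `-β x`, summed against the weights of `ψ`
  have h4 : ∀ F : Finset ι, Real.exp (-(β * x)) *
      ((1 + β * (x + b)) * ∑ i ∈ F, ‖⟪e i, (ψ : E)⟫_ℂ‖ ^ 2 - β * (x + b)) ≤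
      ∑ i ∈ F, Real.exp (-(β * l i)) * ‖⟪e i, (ψ : E)⟫_ℂ‖ ^ 2 := fun F => by
    have h5 : ∀ i, Real.exp (-(β * x)) * (1 + β * (x + b) - β * (l i + b)) ≤
        Real.exp (-(β * l i)) := fun i => by
      have : Real.exp (-(β * l i)) = Real.exp (-(β * x)) * Real.exp (β * x - β * l i) := by
        rw [← Real.exp_add]; congr 1; ring
      rw [this]
      refine mul_le_mul_of_nonneg_left ?_ (Real.exp_pos _).le
      linarith [Real.add_one_le_exp (β * x - β * l i)]
    refine le_trans ?_ (Finset.sum_le_sum fun i _ =>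
      mul_le_mul_of_nonneg_right (h5 i) (sq_nonneg ‖⟪e i, (ψ : E)⟫_ℂ‖))
    simp only [mul_assoc (Real.exp (-(β * x)))]
    rw [← Finset.mul_sum]
    refine mul_le_mul_of_nonneg_left ?_ (Real.exp_pos _).le
    simp only [sub_mul]
    rw [Finset.sum_sub_distrib, ← Finset.mul_sum]
    simp only [mul_assoc β]
    rw [← Finset.mul_sum]
    exact sub_le_sub_left (mul_le_mul_of_nonneg_left (h3 F) hβ.le) _
  have h6 := le_of_tendsto_of_tendsto' (((h2.const_mul (1 + β * (x + b))).sub_const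
    (β * (x + b))).const_mul (Real.exp (-(β * x)))) h1 h4
  simpa using h6

/-- Comparison of the forms of two perturbations on unit vectors compares the traces of their
semigroups: evaluate Jensen's inequality for the second one on an eigenbasis of the first one. -/
lemma IsFormBounded.posTrace_expNeg_le (hA : IsSelfAdjoint A) (hpos : IsBoundedBelowBy A 0)
    (hX : IsFormBounded A X a b) (hY : IsFormBounded A Y a' b') {B : E →L[ℂ] E}
    (hB : IsInverseOfSub A (-1) B) (hc : IsCompactOperator B) {β β' s : ℝ} (hβ : 0 < β)
    (hβ' : 0 < β') (hle : ∀ ψ : formDomain A, ‖(ψ : E)‖ = 1 →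
      β' * ((form A + Y) ψ ψ).re ≤ β * ((form A + X) ψ ψ).re + s) :
    posTrace (expNeg (perturbed A X) β) ≤
      ENNReal.ofReal (Real.exp s) * posTrace (expNeg (perturbed A Y) β') := by
  obtain ⟨ι, e, l, he, f, hfe, hf⟩ := hX.exists_isEigenbasis_perturbed hA hpos hB hc
  rw [posTrace_expNeg_eq_tsum (hX.isSelfAdjoint_perturbed hA hpos)
    (hX.isBoundedBelowBy_perturbed hA hpos) hβ he,
    posTrace_eq_tsum e (expNeg_nonneg (perturbed A Y) β'), ← ENNReal.tsum_mul_left]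
  refine ENNReal.tsum_le_tsum fun i => ?_
  rw [← ENNReal.ofReal_mul (Real.exp_pos s).le]
  refine ENNReal.ofReal_le_ofReal ?_
  have h0 : ‖(f i : E)‖ = 1 := by rw [hfe, e.orthonormal.norm_eq_one]
  have h1 : ((form A + X) (f i) (f i)).re = l i := by
    rw [hf, hfe, inner_self_eq_norm_sq_to_K, e.orthonormal.norm_eq_one]
    simp
  have h2 := hle (f i) h0
  have h3 := hY.exp_neg_form_le hA hpos hB hc hβ' h0
  rw [h1] at h2
  rw [hfe] at h3
  refine le_trans ?_ (mul_le_mul_of_nonneg_left h3 (Real.exp_pos s).le)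
  rw [← Real.exp_add, Real.exp_le_exp]
  linarith

end Forms

end FormPerturbation

theorem lemma4 {E : Type*} [NormedAddCommGroup E] [InnerProductSpace ℂ E] [CompleteSpace E]
    (H₀ : E →ₗ.[ℂ] E) (hsa : IsSelfAdjoint H₀)
    (hpos : FormPerturbation.IsBoundedBelowBy H₀ 0)
    (β₀ : ℝ) (hβ₀ : 0 ≤ β₀)
    (htr : ∀ β : ℝ, β₀ < β → FormPerturbation.IsTraceClass (FormPerturbation.expNeg H₀ β))
    (X : FormPerturbation.formDomain H₀ →ₗ⋆[ℂ] FormPerturbation.formDomain H₀ →ₗ[ℂ] ℂ)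
    (hX : ∀ φ ψ, X φ ψ = (starRingEnd ℂ) (X ψ φ))
    (a b : ℝ) (ha₀ : 0 ≤ a) (ha : a < 1 - β₀)
    (hbd : ∀ ψ : FormPerturbation.formDomain H₀,
      ‖X ψ ψ‖ ≤ a * (FormPerturbation.form H₀ ψ ψ).re + b * ‖(ψ : E)‖ ^ 2) :
    IsSelfAdjoint (FormPerturbation.perturbed H₀ X) ∧
    FormPerturbation.IsBoundedBelowBy (FormPerturbation.perturbed H₀ X) (-b) ∧
    FormPerturbation.HasPurelyDiscreteSpectrum (FormPerturbation.perturbed H₀ X) ∧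
    (∀ β : ℝ, β₀ / (1 - a) < β →
      FormPerturbation.IsTraceClass
        (FormPerturbation.expNeg (FormPerturbation.perturbed H₀ X) β)) ∧
    (∀ β : ℝ, 0 < β →
      ENNReal.ofReal (Real.exp (-(b * β))) *
          FormPerturbation.posTrace (FormPerturbation.expNeg H₀ ((1 + a) * β)) ≤
        FormPerturbation.posTrace
          (FormPerturbation.expNeg (FormPerturbation.perturbed H₀ X) β) ∧
      FormPerturbation.posTrace (FormPerturbation.expNeg (FormPerturbation.perturbed H₀ X) β) ≤
        ENNReal.ofReal (Real.exp (b * β)) *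
          FormPerturbation.posTrace (FormPerturbation.expNeg H₀ ((1 - a) * β))) := by
  have ha1 : a < 1 := by linarith
  have hXb : FormPerturbation.IsFormBounded H₀ X a b := ⟨hX, ha₀, ha1, hbd⟩
  obtain ⟨B, hB⟩ := FormPerturbation.exists_isInverseOfSub hsa hpos (z := -1) (by norm_num)
  push_cast at hB
  have hBc : IsCompactOperator B :=
    FormPerturbation.isCompactOperator_of_isTraceClass_expNeg hsa hpos
      (β := β₀ + 1) (by linarith) (htr _ (by linarith)) hB
  have hXsa := hXb.isSelfAdjoint_perturbed hsa hpos
  have hXbd := hXb.isBoundedBelowBy_perturbed hsa hpos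
  have hzero := FormPerturbation.IsFormBounded.zero H₀
  have hupper : ∀ β : ℝ, 0 < β →
      FormPerturbation.posTrace (FormPerturbation.expNeg (FormPerturbation.perturbed H₀ X) β) ≤
        ENNReal.ofReal (Real.exp (b * β)) *
          FormPerturbation.posTrace (FormPerturbation.expNeg H₀ ((1 - a) * β)) := fun β hβ => by
    have h := hXb.posTrace_expNeg_le hsa hpos hzero hB hBc hβ
      (β' := (1 - a) * β) (s := b * β) (mul_pos (sub_pos.2 ha1) hβ) fun ψ hψ => by
        have h1 := mul_le_mul_of_nonneg_left (hXb.le_add ψ) hβ.le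
        rw [hψ] at h1
        rw [add_zero]
        linarith
    rwa [FormPerturbation.perturbed_zero hsa hpos] at h
  refine ⟨hXsa, hXbd, ?_, fun β hβ => ?_, fun β hβ => ⟨?_, hupper β hβ⟩⟩
  · obtain ⟨R, hR, -, hRc⟩ := hXb.exists_isInverseOfSub_perturbed hsa hpos
    exact FormPerturbation.hasPurelyDiscreteSpectrum hXsa hXbd hR (hRc B hB hBc)
  · have hβ0 : 0 < β := (div_nonneg hβ₀ (sub_nonneg.2 ha1.le)).trans_lt hβ
    rw [div_lt_iff₀' (sub_pos.2 ha1)] at hβ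
    rw [FormPerturbation.isTraceClass_iff_of_nonneg (FormPerturbation.expNeg_nonneg _ _)]
    refine ((hupper β hβ0).trans_lt (ENNReal.mul_lt_top ENNReal.ofReal_lt_top ?_)).ne
    exact ((FormPerturbation.isTraceClass_iff_of_nonneg
      (FormPerturbation.expNeg_nonneg _ _)).1 (htr _ hβ)).lt_top
  · have h := hzero.posTrace_expNeg_le hsa hpos hXb hB hBc
      (β := (1 + a) * β) (β' := β) (s := b * β) (by positivity) hβ fun ψ hψ => by
        have h1 := mul_le_mul_of_nonneg_left (hXb.add_le ψ) hβ.le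
        rw [hψ] at h1
        rw [add_zero]
        linarith
    rw [FormPerturbation.perturbed_zero hsa hpos] at h
    refine (mul_le_mul_right h _).trans_eq ?_
    rw [← mul_assoc, ← ENNReal.ofReal_mul (Real.exp_pos _).le, ← Real.exp_add, neg_add_cancel,
      Real.exp_zero, ENNReal.ofReal_one, one_mul]
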